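/- Fix a countably infinite supply of letters; an alphabet is a finite set of letters, and a language is a set of words over some alphabet. **Visibly pushdown languages.** A pushdown alphabet $\widetilde\Sigma=(\Sigma_c,\Sigma_i,\Sigma_r)$ is an alphabet $\Sigma$ partitioned into call, internal and return letters. A visibly pushdown automaton over $\widetilde\Sigma$ is a nondeterministic finite-state automaton with a stack, without $\varepsilon$-moves, which pushes one symbol when it reads a call letter, pops one symbol when it reads a return letter (if the stack is empty, it stays empty, and the automaton can see this), and leaves the stack unchanged when it reads an internal letter; it accepts by final state, with any stack. **Theories.** For a pushdown alphabet $\widetilde\Sigma$ with set of letters $\Sigma$ and an infinite set $\mathcal X$ of variables ranging over $\Sigma^*$, consider the quantifier-free formulas built with $\neg,\land,\lor,\Rightarrow,\Leftrightarrow$ from atoms of the following types: 1. membership constraints $s\in L$, with $s$ a string term and $L\subseteq\Sigma^*$ given by an automaton; 2. length constraints $\ell_1=\ell_2$ between terms $k_0+k_1|s_1|+\dots+k_n|s_n|$ with $k_j\in\mathbb Z$ and $s_j\in\mathcal X\cup\Sigma^*$; 3. word equations $s=t$ with $s,t\in(\mathcal X\cup\Sigma)^*$. A family of theories is given by saying (a)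 whether membership constraints are absent, or are allowed exactly for regular languages (given by NFAs), for visibly pushdown languages (given by visibly pushdown automata over the fixed $\widetilde\Sigma$), or for deterministic context-free languages (given by deterministic pushdown automata); (b) whether length constraints are allowed; (c) whether string terms are basic (elements of $\mathcal X\cup\Sigma^*$) and there are no word equations, or are arbitrary concatenations (elements of $(\mathcal X\cup\Sigma)^*$) and there are no word equations, or are arbitrary concatenations and word equations are allowed. Membership constraints or word equations must be allowed, so there are 20 families. Each family contains one theory for each $\widetilde\Sigma$. The family $\mathsf{VPL}+\mathsf{CON}$ has membership constraints for visibly pushdown languages, arbitrary concatenations as string terms, no length constraints and no word equations. The language expressed by a variable $x$ occurring in a formula $f$ is the set of values of $x$ under the assignments $\mathcal X\to\Sigma^*$ that satisfy $f$. A language is expressible in a theory if it is expressed by some variable occurring in some formula of the theory, and expressible in a family if it is expressible in some theory of the family. For families $\mathfrak F,\mathfrak G$ write $\mathfrak F\preceq\mathfrak G$ if for every theory $\mathfrak T$ in $\mathfrak F$ there is a theory $\mathfrak T'$ in $\mathfrak G$ such that every language expressible in $\mathfrak T$ is expressible in $\mathfrak T'$. **Theorem.** The class of languages expressible in the family $\mathsf{VPL}+\mathsf{CON}$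 is exactly the class of recursively enumerable languages. Moreover, emptiness and finiteness are undecidable for $\mathsf{VPL}+\mathsf{CON}$ and for every one of the 20 families $\mathfrak F$ with $\mathsf{VPL}+\mathsf{CON}\preceq\mathfrak F$: each such family contains a single theory (with a fixed pushdown alphabet) for which no algorithm decides, given a formula $f$ of the theory and a variable $x$ occurring in $f$, whether the language expressed by $x$ in $f$ is empty, and no algorithm decides whether it is finite. -/

import Mathlib

/-! Quantifier-free theories of string constraints.  Letters and string variables are both named by
natural numbers, so that a finite alphabet is a finite set of naturals and languages over
different alphabets can be compared literally. -/

namespace StringConstraints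

/-- A language, over some finite set of letters taken from the common supply `ℕ` of letters. -/
abbrev Lang := Set (List ℕ)

inductive LetterKind where
  | call
  | internal
  | ret

/-- A finite alphabet with a partition into call, internal and return letters.
The value of `kind` outside `letters` is never used. -/
structure PushdownAlphabet where
  letters : Finset ℕ
  kind : ℕ → LetterKind

/-- `w` is a word over the finite alphabet `S`. -/
def WordOver (S : Finset ℕ) (w : List ℕ) : Prop := ∀ a ∈ w, a ∈ S

/-! ### Automata, as finite data -/

/-- A nondeterministic finite automaton; `(q, a, q')` in `trans` is a move from `q` to `q'`
reading `a`. Its states are those that occur in the finite lists. -/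
structure FA where
  start : List ℕ
  trans : List (ℕ × ℕ × ℕ)
  accept : List ℕ

namespace FA

def toNFA (M : FA) : NFA ℕ ℕ where
  step q a := {q' | (q, a, q') ∈ M.trans}
  start := {q | q ∈ M.start}
  accept := {q | q ∈ M.accept}

def language (M : FA) : Lang := {w | w ∈ M.toNFA.accepts}

def Over (M : FA) (S : Finset ℕ) : Prop := ∀ t ∈ M.trans, t.2.1 ∈ S

def code (M : FA) : ℕ := Encodable.encode (M.start, M.trans, M.accept)

end FA

/-- A (nondeterministic) visibly pushdown automaton.
`(q, a, q', g)` in `callTrans`: reading `a`, go from `q` to `q'` and push `g`.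
`(q, a, q')` in `internalTrans`: reading `a`, go from `q` to `q'`, leaving the stack unchanged.
`(q, a, some g, q')` in `retTrans`: reading `a`, pop `g` and go from `q` to `q'`.
`(q, a, none, q')` in `retTrans`: reading `a` on the empty stack, go from `q` to `q'`. -/
structure VPA where
  start : List ℕ
  callTrans : List (ℕ × ℕ × ℕ × ℕ)
  internalTrans : List (ℕ × ℕ × ℕ)
  retTrans : List (ℕ × ℕ × Option ℕ × ℕ)
  accept : List ℕ

namespace VPA

/-- `M.Step a (q, s) (q', s')`: reading `a`, `M` can go from state `q` with stack `s` (top first)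
to state `q'` with stack `s'`. -/
def Step (M : VPA) (a : ℕ) (c d : ℕ × List ℕ) : Prop :=
  (∃ g, (c.1, a, d.1, g) ∈ M.callTrans ∧ d.2 = g :: c.2) ∨
  ((c.1, a, d.1) ∈ M.internalTrans ∧ d.2 = c.2) ∨
  (∃ g, (c.1, a, some g, d.1) ∈ M.retTrans ∧ c.2 = g :: d.2) ∨
  ((c.1, a, none, d.1) ∈ M.retTrans ∧ c.2 = [] ∧ d.2 = [])

/-- `M` can reach an accepting state (with any stack) from configuration `c` by reading the
given word. -/
def AcceptsFrom (M : VPA) : ℕ × List ℕ → List ℕ → Prop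
  | c, [] => c.1 ∈ M.accept
  | c, a :: w => ∃ d, M.Step a c d ∧ M.AcceptsFrom d w

def language (M : VPA) : Lang := {w | ∃ q ∈ M.start, M.AcceptsFrom (q, []) w}

/-- `M` is a visibly pushdown automaton over the partitioned alphabet `A`: the letter read
determines the kind of stack operation. -/
def Over (M : VPA) (A : PushdownAlphabet) : Prop :=
  (∀ t ∈ M.callTrans, t.2.1 ∈ A.letters ∧ A.kind t.2.1 = .call) ∧
  (∀ t ∈ M.internalTrans, t.2.1 ∈ A.letters ∧ A.kind t.2.1 = .internal) ∧
  (∀ t ∈ M.retTrans, t.2.1 ∈ A.letters ∧ A.kind t.2.1 = .ret)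

def code (M : VPA) : ℕ :=
  Encodable.encode (M.start, M.callTrans, M.internalTrans, M.retTrans, M.accept)

end VPA

/-- A pushdown automaton accepting by final state. `(q, i, g, q', u)` in `trans`: in state `q`
with `g` on top of the stack, read the letter `i` (nothing, if `i = none`), replace `g` by
the word `u` and go to `q'`. -/
structure PDA where
  start : ℕ
  bottom : ℕ
  trans : List (ℕ × Option ℕ × ℕ × ℕ × List ℕ)
  accept : List ℕ

namespace PDA

/-- One move between configurations (state, remaining input, stack with its top first). -/
def Step (M : PDA) (c d : ℕ × List ℕ × List ℕ) : Prop :=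
  ∃ i g u s, (c.1, i, g, d.1, u) ∈ M.trans ∧
    c.2.1 = Option.toList i ++ d.2.1 ∧ c.2.2 = g :: s ∧ d.2.2 = u ++ s

def language (M : PDA) : Lang :=
  {w | ∃ q ∈ M.accept, ∃ s,
    Relation.ReflTransGen M.Step (M.start, w, [M.bottom]) (q, [], s)}

/-- For each state and top symbol there is at most one move per input letter, and a move that
reads nothing excludes every other move. -/
def Deterministic (M : PDA) : Prop :=
  ∀ t ∈ M.trans, ∀ t' ∈ M.trans, t.1 = t'.1 → t.2.2.1 = t'.2.2.1 →
    (t.2.1 = none ∨ t.2.1 = t'.2.1) → t = t'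

def Over (M : PDA) (S : Finset ℕ) : Prop := ∀ t ∈ M.trans, ∀ a, t.2.1 = some a → a ∈ S

def code (M : PDA) : ℕ := Encodable.encode (M.start, M.bottom, M.trans, M.accept)

end PDA

/-- The classes of languages admitted in membership constraints: regular, visibly pushdown,
deterministic context-free. -/
inductive LangClass where
  | reg
  | vpl
  | cf

/-- A description of the language in a membership constraint by an automaton. -/
inductive LangSpec where
  | fa (M : FA)
  | vpa (M : VPA)
  | pda (M : PDA)

namespace LangSpec

def language : LangSpec → Lang
  | fa M => M.language
  | vpa M => M.language
  | pda M => M.language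

/-- The description is one of a language of class `c` over the alphabet `A`. -/
def Admissible (A : PushdownAlphabet) : LangClass → LangSpec → Prop
  | .reg, fa M => M.Over A.letters
  | .vpl, vpa M => M.Over A
  | .cf, pda M => M.Deterministic ∧ M.Over A.letters
  | _, _ => False

def code : LangSpec → ℕ
  | fa M => Nat.pair 0 M.code
  | vpa M => Nat.pair 1 M.code
  | pda M => Nat.pair 2 M.code

end LangSpec

/-! ### Terms and formulas -/

/-- An extended string term: a concatenation of variables `Sum.inl x` and letters `Sum.inr a`. -/
abbrev StrTerm := List (ℕ ⊕ ℕ)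

namespace StrTerm

/-- A basic string term: a single variable, or a constant word. -/
def Basic (s : StrTerm) : Prop := (∃ x, s = [Sum.inl x]) ∨ ∃ w : List ℕ, s = w.map Sum.inr

def Over (s : StrTerm) (S : Finset ℕ) : Prop := ∀ a, Sum.inr a ∈ s → a ∈ S

def Occurs (x : ℕ) (s : StrTerm) : Prop := Sum.inl x ∈ s

/-- The value of a term under the assignment `h`. -/
def eval (h : ℕ → List ℕ) (s : StrTerm) : List ℕ := s.flatMap (Sum.elim h fun a => [a])

end StrTerm

/-- The length term `k₀ + k₁|s₁| + ⋯ + kₙ|sₙ|`, given as `(k₀, [(k₁, s₁), …, (kₙ, sₙ)])`. -/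
abbrev LenTerm := ℤ × List (ℤ × StrTerm)

namespace LenTerm

def WellFormed (l : LenTerm) (S : Finset ℕ) : Prop :=
  ∀ p ∈ l.2, StrTerm.Basic p.2 ∧ StrTerm.Over p.2 S

def Occurs (x : ℕ) (l : LenTerm) : Prop := ∃ p ∈ l.2, StrTerm.Occurs x p.2

def eval (h : ℕ → List ℕ) (l : LenTerm) : ℤ :=
  l.1 + (l.2.map fun p => p.1 * ((StrTerm.eval h p.2).length : ℤ)).sum

end LenTerm

inductive Formula where
  | mem (s : StrTerm) (K : LangSpec)
  | lenEq (l m : LenTerm)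
  | wordEq (s t : StrTerm)
  | not (f : Formula)
  | and (f g : Formula)
  | or (f g : Formula)
  | imp (f g : Formula)
  | iff (f g : Formula)

/-- Which string terms and string equalities are available: basic string terms only; extended
string terms, without equality; extended string terms and word equations. -/
inductive StringOps where
  | basic
  | con
  | we

/-- A family of theories: the class of languages in membership constraints (`none` if there are no
such constraints), whether length constraints are available, and the string operations.
Membership constraints or word equations have to be available; this leaves 20 families. -/
structure Family where
  membership : Option LangClass
  len : Bool
  ops : StringOps
  proper : membership = none → ops = .we

/-- Visibly pushdown membership constraints on concatenations of variables and constants. -/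
def VPLCON : Family := ⟨some .vpl, false, .con, by simp⟩

namespace Formula

/-- The formula `f` belongs to the theory of the family `F` with underlying alphabet `A`. -/
def InTheory (F : Family) (A : PushdownAlphabet) : Formula → Prop
  | mem s K => (F.ops = .basic → StrTerm.Basic s) ∧ StrTerm.Over s A.letters ∧
      ∃ c, F.membership = some c ∧ K.Admissible A c
  | lenEq l m => F.len = true ∧ LenTerm.WellFormed l A.letters ∧ LenTerm.WellFormed m A.letters
  | wordEq s t => F.ops = .we ∧ StrTerm.Over s A.letters ∧ StrTerm.Over t A.letters
  | not f => f.InTheory F A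
  | and f g => f.InTheory F A ∧ g.InTheory F A
  | or f g => f.InTheory F A ∧ g.InTheory F A
  | imp f g => f.InTheory F A ∧ g.InTheory F A
  | iff f g => f.InTheory F A ∧ g.InTheory F A

/-- The variable `x` occurs in the formula. -/
def Occurs (x : ℕ) : Formula → Prop
  | mem s _ => StrTerm.Occurs x s
  | lenEq l m => LenTerm.Occurs x l ∨ LenTerm.Occurs x m
  | wordEq s t => StrTerm.Occurs x s ∨ StrTerm.Occurs x t
  | not f => f.Occurs x
  | and f g => f.Occurs x ∨ g.Occurs x
  | or f g => f.Occurs x ∨ g.Occurs x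
  | imp f g => f.Occurs x ∨ g.Occurs x
  | iff f g => f.Occurs x ∨ g.Occurs x

/-- The formula is true under the assignment `h`. -/
def Holds (h : ℕ → List ℕ) : Formula → Prop
  | mem s K => StrTerm.eval h s ∈ K.language
  | lenEq l m => LenTerm.eval h l = LenTerm.eval h m
  | wordEq s t => StrTerm.eval h s = StrTerm.eval h t
  | not f => ¬ f.Holds h
  | and f g => f.Holds h ∧ g.Holds h
  | or f g => f.Holds h ∨ g.Holds h
  | imp f g => f.Holds h → g.Holds h
  | iff f g => f.Holds h ↔ g.Holds h

/-- The language expressed by the variable `x` in the formula `f`, variables ranging over the words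
over the alphabet `A`. -/
def language (A : PushdownAlphabet) (f : Formula) (x : ℕ) : Lang :=
  {w | ∃ h : ℕ → List ℕ, (∀ y, WordOver A.letters (h y)) ∧ f.Holds h ∧ h x = w}

/-- A numbering of the formulas, through which they are given to algorithms. -/
def code : Formula → ℕ
  | mem s K => Nat.pair 0 (Nat.pair (Encodable.encode s) K.code)
  | lenEq l m => Nat.pair 1 (Nat.pair (Encodable.encode l) (Encodable.encode m))
  | wordEq s t => Nat.pair 2 (Nat.pair (Encodable.encode s) (Encodable.encode t))
  | not f => Nat.pair 3 f.code
  | and f g => Nat.pair 4 (Nat.pair f.code g.code)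
  | or f g => Nat.pair 5 (Nat.pair f.code g.code)
  | imp f g => Nat.pair 6 (Nat.pair f.code g.code)
  | iff f g => Nat.pair 7 (Nat.pair f.code g.code)

end Formula

theorem LangSpec.code_injective : Function.Injective LangSpec.code := by
  rintro (M | M | M) (M' | M' | M') h <;>
    cases M <;> cases M' <;>
    simp_all [LangSpec.code, FA.code, VPA.code, PDA.code, Nat.pair_eq_pair]

/-- Different formulas have different codes. -/
theorem Formula.code_injective : Function.Injective Formula.code := by
  intro f
  induction f <;> intro g <;> cases g <;>
    simp only [Formula.code, Nat.pair_eq_pair, Encodable.encode_inj,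
      LangSpec.code_injective.eq_iff] <;> grind

/-! ### Expressible languages and decision problems -/

/-- `L` is expressible in the theory of the family `F` with underlying alphabet `A`. -/
def Expressible (F : Family) (A : PushdownAlphabet) (L : Lang) : Prop :=
  ∃ f : Formula, f.InTheory F A ∧ ∃ x, f.Occurs x ∧ f.language A x = L

/-- The class of languages expressible in the family `F`, that is, in some theory of `F`. -/
def Family.expressibleLanguages (F : Family) : Set Lang := {L | ∃ A, Expressible F A L}

/-- `F ⪯ G`: for each theory of `F` there is a theory of `G` in which every language expressible in
the former is expressible. -/
def Family.Below (F G : Family) : Prop :=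
  ∀ A, ∃ B, ∀ L, Expressible F A L → Expressible G B L

/-- The class of recursively enumerable languages over finite alphabets. -/
def RELanguages : Set Lang :=
  {L | (∃ S : Finset ℕ, ∀ w ∈ L, WordOver S w) ∧ REPred fun w => w ∈ L}

/-- There is an algorithm that decides, given a formula `f` of the theory and a variable `x` occurring
in `f`, whether the language expressed by `x` in `f` has the property `P`. -/
def DecidableInTheory (F : Family) (A : PushdownAlphabet) (P : Lang → Prop) : Prop :=
  ∃ d : ℕ → ℕ → Bool, Computable₂ d ∧
    ∀ f : Formula, f.InTheory F A → ∀ x, f.Occurs x →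
      (d f.code x = true ↔ P (f.language A x))

end StringConstraints

/-!
A language expressible in `VPLCON` is recursively enumerable: whether a given assignment of words to
the finitely many variables of a formula satisfies it is a primitive recursive question, since a
visibly pushdown automaton is run by keeping the list of its reachable configurations
(`Formula.primrecPred_holds`), and the expressed language is a projection of the set of satisfying
assignments (`Formula.rePred_language`).

Conversely, a Turing machine for a recursively enumerable language is turned into a finite
length-preserving rewriting system, which is run on the input padded with blanks
(`Represents.of_tmRule`, `exists_reflTransGen_rewStep_of_reaches`). The key fact is that one visibly
pushdown automaton checks a whole derivation. Take all letters as call letters, and let every letter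
have a return copy. A history `w₀ d w₁ d ⋯ d wₙ`, with `U = w₁ d ⋯ d wₙ₋₁`, is a derivation if and
only if `w₀ d U` is rewritten, by rules applied in parallel, to `U d wₙ`
(`reflTransGen_rewStep_of_history`, `exists_history_of_reflTransGen_rewStep`): comparing the history
with itself shifted by one block checks all the steps simultaneously. If `V` is the reversed return
copy of `U d wₙ`, then this comparison is made by an automaton that reads `w₀ d U V`, pushing
`w₀ d U` and matching the stack with `V` (`VPA.mem_language_compare_iff`); that `V` is indeed the copy
of `U d wₙ` is checked in the same way on `U d wₙ V`. Both words are concatenations of variables and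
constants, and the input word is a factor of `w₀` (`expressible_rewriting`).

For undecidability, let `VPLCON` be below `F`. The unary halting set `haltingWords` is recursively
enumerable, so it is expressed by some variable `x` of some formula `f` in a single theory of `F`. For
every `n` a formula of that theory says that `x` is the word `0ⁿ`, whichever kind of constraint
`F` has. Conjoining it with `f`, a fresh variable expresses all words or no word, according to
whether `n` is in the halting set; hence neither emptiness nor finiteness is decidable
(`not_decidableInTheory_of_expressible`). No computability of the translation from `VPLCON` to `F` is
needed, because the formula `f` is fixed.
-/

namespace StringConstraints

/-! ### Expressible languages are recursively enumerable -/

/-- The projection of a computable relation is recursively enumerable. -/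
theorem rePred_exists_of_computablePred {α β : Type*} [Primcodable α] [Denumerable β]
    {p : α × β → Prop} (hp : ComputablePred p) : REPred fun a => ∃ b, p (a, b) := by
  obtain ⟨_, hc⟩ := hp
  have h : Partrec fun a : α =>
      Nat.rfind ((fun n => decide (p (a, Denumerable.ofNat β n)) : ℕ → Bool) : ℕ →. Bool) := by
    refine Partrec.rfind (p := fun a => ((fun n => decide (p (a, Denumerable.ofNat β n)) :
      ℕ → Bool) : ℕ →. Bool)) (Computable.partrec ?_)
    exact hc.comp (Computable.fst.pair ((Computable.ofNat β).comp Computable.snd))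
  refine h.dom_re.of_eq fun a => ?_
  rw [Nat.rfind_dom]
  constructor
  · rintro ⟨n, hn, -⟩
    exact ⟨_, by simpa using hn⟩
  · rintro ⟨b, hb⟩
    exact ⟨Encodable.encode b, by simpa using hb, fun _ => trivial⟩

namespace Formula

theorem holds_congr {h h' : ℕ → List ℕ} :
    ∀ {f : Formula}, (∀ x, f.Occurs x → h x = h' x) → (f.Holds h ↔ f.Holds h') := by
  have hs : ∀ s : StrTerm, (∀ x, StrTerm.Occurs x s → h x = h' x) →
      StrTerm.eval h s = StrTerm.eval h' s := by
    intro s hs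
    refine List.flatMap_congr ?_
    rintro (x | a) ha
    · exact hs x ha
    · rfl
  have hl : ∀ l : LenTerm, (∀ x, LenTerm.Occurs x l → h x = h' x) →
      LenTerm.eval h l = LenTerm.eval h' l := by
    intro l hl
    simp only [LenTerm.eval]
    congr 2
    refine List.map_congr_left fun p hp => ?_
    rw [hs p.2 fun x hx => hl x ⟨p, hp, hx⟩]
  intro f
  induction f with
  | mem s K => intro H; simp only [Holds]; rw [hs s H]
  | lenEq l m =>
    intro H; simp only [Holds]
    rw [hl l fun x hx => H x (.inl hx), hl m fun x hx => H x (.inr hx)]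
  | wordEq s t =>
    intro H; simp only [Holds]
    rw [hs s fun x hx => H x (.inl hx), hs t fun x hx => H x (.inr hx)]
  | not f hf => intro H; simp only [Holds]; rw [hf H]
  | and f g hf hg | or f g hf hg | imp f g hf hg | iff f g hf hg =>
    intro H; simp only [Holds]
    rw [hf fun x hx => H x (.inl hx), hg fun x hx => H x (.inr hx)]

/-- Only finitely many variables occur in a formula. -/
theorem exists_forall_le_not_occurs : ∀ f : Formula, ∃ N, ∀ x, N ≤ x → ¬ f.Occurs x := by
  have hs : ∀ s : StrTerm, ∃ N, ∀ x, N ≤ x → ¬ StrTerm.Occurs x s := by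
    intro s
    induction s with
    | nil => exact ⟨0, fun x _ => by simp [StrTerm.Occurs]⟩
    | cons a s ih =>
      obtain ⟨N, hN⟩ := ih
      rcases a with y | y
      · refine ⟨max N (y + 1), fun x hx => ?_⟩
        have := hN x (by omega)
        simp only [StrTerm.Occurs, List.mem_cons, Sum.inl.injEq, not_or] at *
        exact ⟨by omega, this⟩
      · exact ⟨N, fun x hx => by simpa [StrTerm.Occurs] using hN x hx⟩
  have hl : ∀ l : LenTerm, ∃ N, ∀ x, N ≤ x → ¬ LenTerm.Occurs x l := by
    rintro ⟨k, l⟩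
    induction l with
    | nil => exact ⟨0, fun x _ => by simp [LenTerm.Occurs]⟩
    | cons a s ih =>
      obtain ⟨N, hN⟩ := ih
      obtain ⟨M, hM⟩ := hs a.2
      refine ⟨max N M, fun x hx => ?_⟩
      rintro ⟨p, hp, hx'⟩
      rcases List.mem_cons.1 hp with rfl | hp
      · exact hM x (by omega) hx'
      · exact hN x (by omega) ⟨p, hp, hx'⟩
  have hmax : ∀ {P Q : ℕ → Prop}, (∃ N, ∀ x, N ≤ x → ¬ P x) → (∃ N, ∀ x, N ≤ x → ¬ Q x) →
      ∃ N, ∀ x, N ≤ x → ¬ (P x ∨ Q x) := by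
    rintro P Q ⟨N, hN⟩ ⟨M, hM⟩
    exact ⟨max N M, fun x hx h => h.elim (hN x (by omega)) (hM x (by omega))⟩
  intro f
  induction f with
  | mem s K => exact hs s
  | lenEq l m => exact hmax (hl l) (hl m)
  | wordEq s t => exact hmax (hs s) (hs t)
  | not f hf => exact hf
  | and f g hf hg | or f g hf hg | imp f g hf hg | iff f g hf hg => exact hmax hf hg

end Formula

namespace VPA

/-- The list of configurations that `M` can reach from `c` by reading the letter `a`. -/
def next (M : VPA) (a : ℕ) (c : ℕ × List ℕ) : List (ℕ × List ℕ) :=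
  (M.callTrans.filterMap fun t =>
    if t.1 = c.1 ∧ t.2.1 = a then some (t.2.2.1, t.2.2.2 :: c.2) else none) ++
  (M.internalTrans.filterMap fun t =>
    if t.1 = c.1 ∧ t.2.1 = a then some (t.2.2, c.2) else none) ++
  (M.retTrans.filterMap fun t =>
    if t.1 = c.1 ∧ t.2.1 = a ∧ t.2.2.1 = c.2.head? then some (t.2.2.2, c.2.tail) else none)

theorem mem_next {M : VPA} {a : ℕ} {c d : ℕ × List ℕ} : d ∈ M.next a c ↔ M.Step a c d := by
  obtain ⟨q, s⟩ := c
  obtain ⟨q', s'⟩ := d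
  simp only [next, Step, List.mem_append, List.mem_filterMap, Option.ite_none_right_eq_some,
    Option.some.injEq, Prod.mk.injEq, Prod.exists, or_assoc]
  refine or_congr ?_ (or_congr ?_ ?_)
  · constructor
    · rintro ⟨_, _, _, g, ht, ⟨rfl, rfl⟩, rfl, rfl⟩
      exact ⟨g, ht, rfl⟩
    · rintro ⟨g, ht, rfl⟩
      exact ⟨_, _, _, g, ht, ⟨rfl, rfl⟩, rfl, rfl⟩
  · constructor
    · rintro ⟨_, _, _, ht, ⟨rfl, rfl⟩, rfl, rfl⟩
      exact ⟨ht, rfl⟩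
    · rintro ⟨ht, rfl⟩
      exact ⟨_, _, _, ht, ⟨rfl, rfl⟩, rfl, rfl⟩
  · constructor
    · rintro ⟨_, _, o, _, ht, ⟨rfl, rfl, rfl⟩, rfl, rfl⟩
      rcases s with - | ⟨g, s⟩
      · exact .inr ⟨ht, rfl, rfl⟩
      · exact .inl ⟨g, ht, rfl⟩
    · rintro (⟨g, ht, rfl⟩ | ⟨ht, rfl, rfl⟩)
      · exact ⟨_, _, _, _, ht, ⟨rfl, rfl, rfl⟩, rfl, rfl⟩
      · exact ⟨_, _, _, _, ht, ⟨rfl, rfl, rfl⟩, rfl, rfl⟩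

/-- The list of configurations that `M` can reach from those in `C` by reading a word. -/
def run (M : VPA) (C : List (ℕ × List ℕ)) (w : List ℕ) : List (ℕ × List ℕ) :=
  w.foldl (fun C a => C.flatMap (M.next a)) C

theorem exists_mem_run_iff {M : VPA} {w : List ℕ} {C : List (ℕ × List ℕ)} :
    (∃ d ∈ M.run C w, d.1 ∈ M.accept) ↔ ∃ c ∈ C, M.AcceptsFrom c w := by
  induction w generalizing C with
  | nil => rfl
  | cons a w ih =>
    refine (ih (C := C.flatMap (M.next a))).trans ?_
    simp only [List.mem_flatMap, mem_next, AcceptsFrom]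
    exact ⟨fun ⟨d, ⟨c, hc, hd⟩, h⟩ => ⟨c, hc, d, hd, h⟩,
      fun ⟨c, hc, d, hd, h⟩ => ⟨d, ⟨c, hc, hd⟩, h⟩⟩

theorem mem_language_iff_run {M : VPA} {w : List ℕ} :
    w ∈ M.language ↔ ∃ d ∈ M.run (M.start.map fun q => (q, [])) w, d.1 ∈ M.accept := by
  rw [exists_mem_run_iff]
  simp [language]

theorem primrec_next (M : VPA) : Primrec₂ M.next := by
  have hc : Primrec fun p : (ℕ × ℕ × List ℕ) × (ℕ × ℕ × ℕ × ℕ) => p.1.2 :=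
    Primrec.snd.comp Primrec.fst
  refine Primrec.list_append.comp (Primrec.list_append.comp ?_ ?_) ?_
  · refine Primrec.listFilterMap (Primrec.const _) ?_
    unfold Primrec₂
    have ht : Primrec fun p : (ℕ × ℕ × List ℕ) × (ℕ × ℕ × ℕ × ℕ) => p.2 := Primrec.snd
    refine Primrec.ite ((Primrec.eq.comp (Primrec.fst.comp ht) (Primrec.fst.comp hc)).and
      (Primrec.eq.comp (Primrec.fst.comp (Primrec.snd.comp ht)) (Primrec.fst.comp Primrec.fst)))
      (Primrec.option_some.comp (.pair ?_ (Primrec.list_cons.comp ?_ (Primrec.snd.comp hc))))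
      (Primrec.const _)
    · exact Primrec.fst.comp (Primrec.snd.comp (Primrec.snd.comp ht))
    · exact Primrec.snd.comp (Primrec.snd.comp (Primrec.snd.comp ht))
  · refine Primrec.listFilterMap (Primrec.const _) ?_
    unfold Primrec₂
    have hc : Primrec fun p : (ℕ × ℕ × List ℕ) × (ℕ × ℕ × ℕ) => p.1.2 :=
      Primrec.snd.comp Primrec.fst
    have ht : Primrec fun p : (ℕ × ℕ × List ℕ) × (ℕ × ℕ × ℕ) => p.2 := Primrec.snd
    refine Primrec.ite ((Primrec.eq.comp (Primrec.fst.comp ht) (Primrec.fst.comp hc)).and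
      (Primrec.eq.comp (Primrec.fst.comp (Primrec.snd.comp ht)) (Primrec.fst.comp Primrec.fst)))
      (Primrec.option_some.comp (.pair ?_ (Primrec.snd.comp hc))) (Primrec.const _)
    exact Primrec.snd.comp (Primrec.snd.comp ht)
  · refine Primrec.listFilterMap (Primrec.const _) ?_
    unfold Primrec₂
    have hc : Primrec fun p : (ℕ × ℕ × List ℕ) × (ℕ × ℕ × Option ℕ × ℕ) => p.1.2 :=
      Primrec.snd.comp Primrec.fst
    have ht : Primrec fun p : (ℕ × ℕ × List ℕ) × (ℕ × ℕ × Option ℕ × ℕ) => p.2 := Primrec.snd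
    refine Primrec.ite ((Primrec.eq.comp (Primrec.fst.comp ht) (Primrec.fst.comp hc)).and
      ((Primrec.eq.comp (Primrec.fst.comp (Primrec.snd.comp ht))
        (Primrec.fst.comp Primrec.fst)).and
      (Primrec.eq.comp (Primrec.fst.comp (Primrec.snd.comp (Primrec.snd.comp ht)))
        (Primrec.list_head?.comp (Primrec.snd.comp hc)))))
      (Primrec.option_some.comp (.pair ?_ (Primrec.list_tail.comp (Primrec.snd.comp hc))))
      (Primrec.const _)
    exact Primrec.snd.comp (Primrec.snd.comp (Primrec.snd.comp ht))

theorem primrecPred_mem_language (M : VPA) : PrimrecPred fun w => w ∈ M.language := by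
  have hrun : Primrec fun w => M.run (M.start.map fun q => (q, [])) w := by
    refine Primrec.list_foldl
      (h := fun (_ : List ℕ) (p : List (ℕ × List ℕ) × ℕ) => p.1.flatMap (M.next p.2)) Primrec.id
      (Primrec.const _) ?_
    refine Primrec.list_flatMap (Primrec.fst.comp Primrec.snd) ?_
    exact M.primrec_next.comp (Primrec.snd.comp (Primrec.snd.comp Primrec.fst)) Primrec.snd
  have hacc : PrimrecPred fun d : ℕ × List ℕ => d.1 ∈ M.accept := by
    have := (PrimrecRel.exists_mem_list (R := fun a b : ℕ => a = b) Primrec.eq).comp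
      (Primrec.const M.accept) (Primrec.fst (α := ℕ) (β := List ℕ))
    exact this.of_eq fun d => by simp
  exact (hacc.exists_mem_list.comp hrun).of_eq fun w => mem_language_iff_run.symm

end VPA

/-- An assignment given by the list of its values at `0`, `1`, …, all further values being the empty
word. -/
def assignmentOfList (l : List (List ℕ)) (x : ℕ) : List ℕ := l.getD x []

theorem Formula.primrecPred_holds {A : PushdownAlphabet} :
    ∀ {f : Formula}, f.InTheory VPLCON A → PrimrecPred fun l => f.Holds (assignmentOfList l) := by
  intro f
  induction f with
  | mem s K =>
    rintro ⟨-, -, c, hc, hK⟩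
    obtain rfl : LangClass.vpl = c := by simpa [VPLCON] using hc
    cases K with
    | fa M => exact hK.elim
    | pda M => exact hK.elim
    | vpa M =>
      refine M.primrecPred_mem_language.comp ?_
      induction s with
      | nil => exact Primrec.const _
      | cons a s ih =>
        refine (Primrec.list_append.comp ?_ ih)
        rcases a with x | a
        · exact (Primrec.list_getD []).comp Primrec.id (Primrec.const x)
        · exact Primrec.const _
  | lenEq l m => rintro ⟨h, -⟩; cases h
  | wordEq s t => rintro ⟨h, -⟩; cases h
  | not f hf => exact fun h => (hf h).not
  | and f g hf hg => exact fun h => (hf h.1).and (hg h.2)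
  | or f g hf hg => exact fun h => (hf h.1).or (hg h.2)
  | imp f g hf hg =>
    exact fun h => ((hf h.1).not.or (hg h.2)).of_eq fun l => by simp only [Holds]; tauto
  | iff f g hf hg =>
    exact fun h => (((hf h.1).and (hg h.2)).or ((hf h.1).not.and (hg h.2).not)).of_eq
      fun l => by simp only [Holds]; tauto

theorem Formula.rePred_language {A : PushdownAlphabet} {f : Formula} (hf : f.InTheory VPLCON A)
    (x : ℕ) : REPred fun w => w ∈ f.language A x := by
  have hletter : PrimrecPred fun a => a ∈ A.letters := by
    have := (PrimrecRel.exists_mem_list (R := fun a b : ℕ => a = b) Primrec.eq).comp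
      (Primrec.const A.letters.toList) Primrec.id
    exact this.of_eq fun d => by simp
  have hover : PrimrecPred fun l : List (List ℕ) => ∀ v ∈ l, WordOver A.letters v :=
    hletter.forall_mem_list.forall_mem_list
  have hp : PrimrecPred fun p : List ℕ × List (List ℕ) => (∀ v ∈ p.2, WordOver A.letters v) ∧
      f.Holds (assignmentOfList p.2) ∧ assignmentOfList p.2 x = p.1 :=
    (hover.comp Primrec.snd).and <| ((primrecPred_holds hf).comp Primrec.snd).and <|
      Primrec.eq.comp ((Primrec.list_getD []).comp Primrec.snd (Primrec.const x)) Primrec.fst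
  have hc : ComputablePred fun p : List ℕ × List (List ℕ) => (∀ v ∈ p.2, WordOver A.letters v) ∧
      f.Holds (assignmentOfList p.2) ∧ assignmentOfList p.2 x = p.1 := by
    obtain ⟨_, h⟩ := hp
    exact ⟨_, h.to_comp⟩
  refine (rePred_exists_of_computablePred hc).of_eq fun w => ?_
  constructor
  · rintro ⟨l, hl, hf, hx⟩
    refine ⟨assignmentOfList l, fun y => ?_, hf, hx⟩
    rcases lt_or_ge y l.length with hy | hy
    · simpa [assignmentOfList, hy] using hl _ (List.getElem_mem hy)
    · simp [assignmentOfList, hy, WordOver]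
  · rintro ⟨h, hh, hf, hx⟩
    obtain ⟨N, hN⟩ := exists_forall_le_not_occurs f
    -- only the values at the variables below `N` and at `x` matter
    have key : ∀ y, y < max N (x + 1) →
        assignmentOfList ((List.range (max N (x + 1))).map h) y = h y := by
      intro y hy
      simp [assignmentOfList, List.getD_eq_getElem?_getD, List.getElem?_range hy]
    refine ⟨(List.range (max N (x + 1))).map h, ?_, ?_, ?_⟩
    · simp only [List.mem_map, forall_exists_index, and_imp, forall_apply_eq_imp_iff₂]
      exact fun y _ => hh y
    · refine (holds_congr fun y hy => ?_).2 hf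
      refine key y (lt_max_of_lt_left ?_)
      by_contra hlt
      exact hN y (not_lt.1 hlt) hy
    · rw [← hx]; exact key x (by simp)

theorem VPLCON_expressibleLanguages_subset : VPLCON.expressibleLanguages ⊆ RELanguages := by
  rintro L ⟨A, f, hf, x, -, rfl⟩
  refine ⟨⟨A.letters, ?_⟩, Formula.rePred_language hf x⟩
  rintro w ⟨h, hh, -, rfl⟩
  exact hh x

/-! ### Undecidability -/

theorem FA.replicate_mem_language_iff (n m : ℕ) :
    List.replicate m 0 ∈ (FA.mk [0] ((List.range n).map fun i => (i, 0, i + 1)) [n]).language ↔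
      m = n := by
  set M := FA.mk [0] ((List.range n).map fun i => (i, 0, i + 1)) [n] with hM
  have key : ∀ m j, j ∈ M.toNFA.evalFrom M.toNFA.start (List.replicate m 0) ↔ j = m ∧ m ≤ n := by
    intro m
    induction m with
    | zero => intro j; simp [FA.toNFA, hM]
    | succ m ih =>
      intro j
      rw [List.replicate_succ', NFA.evalFrom_append, NFA.evalFrom_singleton, NFA.mem_stepSet]
      have hstep : ∀ t, j ∈ M.toNFA.step t 0 ↔ t < n ∧ t + 1 = j := by
        intro t
        simp only [FA.toNFA, hM, List.mem_map, List.mem_range, Set.mem_ofPred_eq, Prod.mk.injEq,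
          true_and]
        exact ⟨fun ⟨i, hi, h, h'⟩ => h ▸ ⟨hi, h'⟩, fun ⟨hi, h'⟩ => ⟨t, hi, rfl, h'⟩⟩
      simp only [ih, hstep]
      constructor
      · rintro ⟨t, ⟨rfl, _⟩, hi, rfl⟩
        exact ⟨rfl, hi⟩
      · rintro ⟨rfl, hm⟩
        exact ⟨m, ⟨rfl, by omega⟩, hm, rfl⟩
  change (∃ S ∈ M.toNFA.accept, S ∈ M.toNFA.evalFrom M.toNFA.start (List.replicate m 0)) ↔ m = n
  simp only [key]
  constructor
  · rintro ⟨S, hS, rfl, -⟩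
    simpa [FA.toNFA, hM] using hS
  · rintro rfl
    exact ⟨m, by simp [FA.toNFA, hM], rfl, le_rfl⟩

/-- Over the one-letter words, a visibly pushdown automaton that increments its state up to `n`
counts to `n`; `P` is an invariant of the stack, and `g` the effect of a move on the stack. -/
theorem VPA.acceptsFrom_replicate_iff {M : VPA} {n : ℕ} (hacc : M.accept = [n])
    {P : List ℕ → Prop} {g : List ℕ → List ℕ} (hP : ∀ s, P s → P (g s))
    (hstep : ∀ i s d, P s → (M.Step 0 (i, s) d ↔ i < n ∧ d = (i + 1, g s))) (m i : ℕ)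
    {s : List ℕ} (hs : P s) (hi : i ≤ n) :
    M.AcceptsFrom (i, s) (List.replicate m 0) ↔ i + m = n := by
  induction m generalizing i s with
  | zero => simp [AcceptsFrom, hacc]
  | succ m ih =>
    simp only [List.replicate_succ, AcceptsFrom, hstep _ _ _ hs]
    constructor
    · rintro ⟨d, ⟨hi, rfl⟩, h⟩
      have := (ih _ (hP _ hs) hi).1 h
      omega
    · intro h
      have hi : i < n := by omega
      exact ⟨_, ⟨hi, rfl⟩, (ih _ (hP _ hs) hi).2 (by omega)⟩

/-- A visibly pushdown automaton that counts to `n`, for a letter `0` of kind `k`. -/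
def VPA.counter (n : ℕ) : LetterKind → VPA
  | .call => ⟨[0], (List.range n).map fun i => (i, 0, i + 1, 0), [], [], [n]⟩
  | .internal => ⟨[0], [], (List.range n).map fun i => (i, 0, i + 1), [], [n]⟩
  | .ret => ⟨[0], [], [], (List.range n).map fun i => (i, 0, none, i + 1), [n]⟩

theorem VPA.replicate_mem_language_counter_iff (n m : ℕ) (k : LetterKind) :
    List.replicate m 0 ∈ (counter n k).language ↔ m = n := by
  have hstart : (counter n k).start = [0] := by cases k <;> rfl
  have hacc : (counter n k).accept = [n] := by cases k <;> rfl
  simp only [language, hstart, List.mem_singleton, exists_eq_left, Set.mem_ofPred_eq]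
  have h := fun P g hP hstep hs =>
    acceptsFrom_replicate_iff (P := P) (g := g) hacc hP hstep m 0 (s := []) hs n.zero_le
  rw [zero_add] at h
  cases k with
  | call =>
    refine h (fun _ => True) (fun s => 0 :: s) (fun _ _ => trivial) ?_ trivial
    rintro i s ⟨j, t⟩ -
    simp only [Step, counter, List.mem_map, List.mem_range, Prod.mk.injEq, List.not_mem_nil]
    grind
  | internal =>
    refine h (fun _ => True) id (fun _ _ => trivial) ?_ trivial
    rintro i s ⟨j, t⟩ -
    simp only [Step, counter, List.mem_map, List.mem_range, Prod.mk.injEq, List.not_mem_nil]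
    grind
  | ret =>
    refine h (fun s => s = []) id (fun _ h => h) ?_ rfl
    rintro i s ⟨j, t⟩ rfl
    simp only [Step, counter, List.mem_map, List.mem_range, Prod.mk.injEq, List.not_mem_nil]
    grind

theorem PDA.replicate_mem_language_iff (n m : ℕ) :
    List.replicate m 0 ∈
      (PDA.mk 0 0 ((List.range n).map fun i => (i, some 0, 0, i + 1, [0])) [n]).language ↔
      m = n := by
  set M := PDA.mk 0 0 ((List.range n).map fun i => (i, some 0, 0, i + 1, [0])) [n] with hM
  have hstep : ∀ c d, M.Step c d ↔ ∃ i < n, ∃ v s, c = (i, 0 :: v, 0 :: s) ∧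
      d = (i + 1, v, 0 :: s) := by
    rintro ⟨i, v, s⟩ ⟨j, v', s'⟩
    simp only [Step, hM, List.mem_map, List.mem_range, Prod.mk.injEq]
    constructor
    · rintro ⟨_, _, _, s, ⟨i, hi, rfl, rfl, rfl, rfl, rfl⟩, rfl, rfl, rfl⟩
      exact ⟨i, hi, v', s, ⟨rfl, rfl, rfl⟩, rfl, rfl, rfl⟩
    · rintro ⟨i, hi, v, s, ⟨rfl, rfl, rfl⟩, rfl, rfl, rfl⟩
      exact ⟨some 0, 0, [0], s, ⟨i, hi, rfl, rfl, rfl, rfl, rfl⟩, rfl, rfl, rfl⟩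
  constructor
  · rintro ⟨q, hq, s, h⟩
    have key : ∀ c, Relation.ReflTransGen M.Step (M.start, List.replicate m 0, [M.bottom]) c →
        c.1 + c.2.1.length = m := by
      intro c hc
      induction hc with
      | refl => simp [hM]
      | tail _ hs ih =>
        obtain ⟨i, -, v, s, rfl, rfl⟩ := (hstep _ _).1 hs
        simp only [List.length_cons] at ih ⊢
        omega
    have := key _ h
    have hq : q = n := by simpa [hM] using hq
    simp only [List.length_nil] at this
    omega
  · rintro rfl
    refine ⟨m, by simp [hM], [0], ?_⟩
    have key : ∀ i ≤ m, Relation.ReflTransGen M.Step (M.start, List.replicate m 0, [M.bottom])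
        (i, List.replicate (m - i) 0, [0]) := by
      intro i
      induction i with
      | zero => intro _; exact .refl
      | succ i ih =>
        intro hi
        refine (ih (by omega)).tail ((hstep _ _).2 ⟨i, hi, _, [], ?_, rfl⟩)
        rw [← List.replicate_succ, show m - (i + 1) + 1 = m - i by omega]
    simpa using key m le_rfl

/-- A description of a language of class `c` that has `0ⁿ` as its only word in `0*`. -/
def LangSpec.counter (k : LetterKind) (n : ℕ) : LangClass → LangSpec
  | .reg => .fa ⟨[0], (List.range n).map fun i => (i, 0, i + 1), [n]⟩
  | .vpl => .vpa (VPA.counter n k)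
  | .cf => .pda ⟨0, 0, (List.range n).map fun i => (i, some 0, 0, i + 1, [0]), [n]⟩

theorem LangSpec.replicate_mem_language_counter_iff (k : LetterKind) (n m : ℕ) (c : LangClass) :
    List.replicate m 0 ∈ (counter k n c).language ↔ m = n := by
  cases c with
  | reg => exact FA.replicate_mem_language_iff n m
  | vpl => exact VPA.replicate_mem_language_counter_iff n m k
  | cf => exact PDA.replicate_mem_language_iff n m

theorem LangSpec.admissible_counter {A : PushdownAlphabet} (h0 : 0 ∈ A.letters) (n : ℕ)
    (c : LangClass) : (counter (A.kind 0) n c).Admissible A c := by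
  cases c with
  | reg =>
    intro t ht
    obtain ⟨i, -, rfl⟩ := List.mem_map.1 ht
    exact h0
  | vpl =>
    simp only [counter, Admissible, VPA.Over]
    cases hk : A.kind 0 <;> simp [VPA.counter, h0, hk]
  | cf =>
    refine ⟨?_, ?_⟩
    · intro t ht t' ht' h _ _
      obtain ⟨i, -, rfl⟩ := List.mem_map.1 ht
      obtain ⟨j, -, rfl⟩ := List.mem_map.1 ht'
      obtain rfl : i = j := h
      rfl
    · intro t ht a ha
      obtain ⟨i, -, rfl⟩ := List.mem_map.1 ht
      obtain rfl : 0 = a := by simpa using ha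
      exact h0

theorem LangSpec.primrec_code_counter (k : LetterKind) (c : LangClass) :
    Primrec fun n => (counter k n c).code := by
  have hmap : ∀ {σ : Type} [Primcodable σ] {g : ℕ → σ}, Primrec g →
      Primrec fun n => (List.range n).map g := fun hg =>
    Primrec.list_map Primrec.list_range (hg.comp Primrec.snd)
  have hacc : Primrec fun n : ℕ => [n] :=
    Primrec.list_cons.comp Primrec.id (Primrec.const [])
  cases c with
  | reg =>
    exact Primrec₂.natPair.comp (Primrec.const 0) <| Primrec.encode.comp <|
      Primrec.pair (Primrec.const [0]) <| Primrec.pair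
        (hmap (Primrec.pair Primrec.id (Primrec.pair (Primrec.const 0) Primrec.succ))) hacc
  | cf =>
    exact Primrec₂.natPair.comp (Primrec.const 2) <| Primrec.encode.comp <|
      Primrec.pair (Primrec.const 0) <| Primrec.pair (Primrec.const 0) <| Primrec.pair
        (hmap (Primrec.pair Primrec.id (Primrec.pair (Primrec.const (some 0)) (Primrec.pair
          (Primrec.const 0) (Primrec.pair Primrec.succ (Primrec.const [0])))))) hacc
  | vpl =>
    refine Primrec₂.natPair.comp (Primrec.const 1) ?_
    cases k with
    | call =>
      exact Primrec.encode.comp <| Primrec.pair (Primrec.const [0]) <| Primrec.pair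
        (hmap (Primrec.pair Primrec.id (Primrec.pair (Primrec.const 0)
          (Primrec.pair Primrec.succ (Primrec.const 0))))) <|
        Primrec.pair (Primrec.const []) <| Primrec.pair (Primrec.const []) hacc
    | internal =>
      exact Primrec.encode.comp <| Primrec.pair (Primrec.const [0]) <|
        Primrec.pair (Primrec.const []) <| Primrec.pair
        (hmap (Primrec.pair Primrec.id (Primrec.pair (Primrec.const 0) Primrec.succ))) <|
        Primrec.pair (Primrec.const []) hacc
    | ret =>
      exact Primrec.encode.comp <| Primrec.pair (Primrec.const [0]) <|
        Primrec.pair (Primrec.const []) <| Primrec.pair (Primrec.const []) <| Primrec.pair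
        (hmap (Primrec.pair Primrec.id (Primrec.pair (Primrec.const 0)
          (Primrec.pair (Primrec.const none) Primrec.succ)))) hacc

namespace Formula

/-- A formula of the family `F` stating that `x`, if it is a word in `0*`, is the word `0ⁿ`. -/
def isPow (F : Family) (A : PushdownAlphabet) (n x : ℕ) : Formula :=
  match F.membership with
  | some c => mem [Sum.inl x] (LangSpec.counter (A.kind 0) n c)
  | none => wordEq [Sum.inl x] ((List.replicate n 0).map Sum.inr)

theorem isPow_inTheory (F : Family) {A : PushdownAlphabet} (h0 : 0 ∈ A.letters) (n x : ℕ) :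
    (isPow F A n x).InTheory F A := by
  have hx : StrTerm.Over [Sum.inl x] A.letters := by intro a ha; simp at ha
  unfold isPow
  split
  case h_1 c hc =>
    exact ⟨fun _ => .inl ⟨x, rfl⟩, hx, c, hc, LangSpec.admissible_counter h0 n c⟩
  case h_2 hc =>
    refine ⟨F.proper hc, hx, ?_⟩
    intro a ha
    obtain rfl : a = 0 := by simpa using (show _ ∧ a = 0 by simpa using ha).2
    exact h0

theorem isPow_occurs (F : Family) (A : PushdownAlphabet) (n x : ℕ) : (isPow F A n x).Occurs x := by
  unfold isPow
  split <;> simp [Occurs, StrTerm.Occurs]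

theorem isPow_holds_iff (F : Family) (A : PushdownAlphabet) {n x m : ℕ} {h : ℕ → List ℕ}
    (hx : h x = List.replicate m 0) : (isPow F A n x).Holds h ↔ m = n := by
  have h1 : StrTerm.eval h [Sum.inl x] = List.replicate m 0 := by simp [StrTerm.eval, hx]
  unfold isPow
  split
  · simp only [Holds, h1, LangSpec.replicate_mem_language_counter_iff]
  · have h2 : StrTerm.eval h ((List.replicate n 0).map Sum.inr) = List.replicate n 0 := by
      simp only [StrTerm.eval, List.flatMap_map, Sum.elim_inr]
      exact List.flatMap_singleton' _
    simp only [Holds, h1, h2]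
    exact ⟨fun h => by simpa using congrArg List.length h, fun h => h ▸ rfl⟩

theorem primrec_code_isPow (F : Family) (A : PushdownAlphabet) (x : ℕ) :
    Primrec fun n => (isPow F A n x).code := by
  unfold isPow
  split
  · exact Primrec₂.natPair.comp (Primrec.const 0) <|
      Primrec₂.natPair.comp (Primrec.const _) (LangSpec.primrec_code_counter _ _)
  · refine Primrec₂.natPair.comp (Primrec.const 2) <| Primrec₂.natPair.comp (Primrec.const _) <|
      Primrec.encode.comp ?_
    refine (Primrec.list_map (f := List.range) (g := fun _ _ => (Sum.inr 0 : ℕ ⊕ ℕ))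
      Primrec.list_range (Primrec.const _)).of_eq fun n => ?_
    simp [List.map_const']

end Formula

open Nat.Partrec in
/-- The unary encoding of the halting problem. -/
def haltingWords : Lang :=
  {w | (∀ a ∈ w, a = 0) ∧ (Code.eval (Denumerable.ofNat Code w.length) 0).Dom}

theorem haltingWords_mem_RELanguages : haltingWords ∈ RELanguages := by
  refine ⟨⟨{0}, fun w hw a ha => by simpa using hw.1 a ha⟩, ?_⟩
  have hall : PrimrecPred fun w : List ℕ => ∀ a ∈ w, a = 0 :=
    PrimrecPred.forall_mem_list (Primrec.eq.comp Primrec.id (Primrec.const 0))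
  obtain ⟨_, hall⟩ := hall
  have heval : Partrec fun w : List ℕ =>
      Nat.Partrec.Code.eval (Denumerable.ofNat Nat.Partrec.Code w.length) 0 :=
    Nat.Partrec.Code.eval_part.comp
      ((Computable.ofNat _).comp Computable.list_length) (Computable.const 0)
  refine (Partrec.cond hall.to_comp heval Partrec.none).dom_re.of_eq fun w => ?_
  by_cases h : ∀ a ∈ w, a = 0
  · simp only [decide_eq_true h, cond_true, haltingWords, Set.mem_ofPred_eq]
    exact ⟨fun h' => ⟨h, h'⟩, fun h' => h'.2⟩
  · simp only [decide_eq_false h, cond_false, haltingWords, Set.mem_ofPred_eq]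
    exact ⟨fun h' => h'.elim, fun h' => (h h'.1).elim⟩

/-- If the unary halting set is expressible in a theory, then no property that separates the empty
language from the infinite languages is decidable for the languages expressible in it. -/
theorem not_decidableInTheory_of_expressible {F : Family} {A : PushdownAlphabet}
    (hL : Expressible F A haltingWords) {P : Lang → Prop} (hempty : P ∅)
    (hinf : ∀ L : Lang, L.Infinite → ¬ P L) : ¬ DecidableInTheory F A P := by
  rintro ⟨d, hd, hdP⟩
  obtain ⟨f, hf, x, hx, hfx⟩ := hL
  obtain ⟨N, hN⟩ := f.exists_forall_le_not_occurs
  have hxN : x < N := by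
    by_contra h
    exact hN x (not_lt.1 h) hx
  -- some code other than that with number `0` halts, so that `0` is a letter of `A`
  have h0 : 0 ∈ A.letters := by
    obtain ⟨n, hn, hn0⟩ : ∃ n, (Nat.Partrec.Code.eval (Denumerable.ofNat Nat.Partrec.Code n) 0).Dom ∧
        n ≠ 0 := by
      refine ⟨Encodable.encode Nat.Partrec.Code.succ, ?_, by decide⟩
      rw [Denumerable.ofNat_encode]
      trivial
    have hw : List.replicate n 0 ∈ f.language A x := by
      rw [hfx]
      exact ⟨fun a ha => List.eq_of_mem_replicate ha, by simpa using hn⟩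
    obtain ⟨h, hh, -, hx⟩ := hw
    exact hh x 0 (by rw [hx]; simp [hn0])
  -- the fresh variable `N` is unconstrained in `g n`
  let g : ℕ → Formula := fun n =>
    .and (.and f (.isPow F A n x)) (.imp (.isPow F A 0 N) (.isPow F A 0 N))
  have hg : ∀ n, (g n).InTheory F A := fun n =>
    ⟨⟨hf, Formula.isPow_inTheory F h0 n x⟩, Formula.isPow_inTheory F h0 0 N,
      Formula.isPow_inTheory F h0 0 N⟩
  have hgN : ∀ n, (g n).Occurs N := fun n => .inr (.inl (Formula.isPow_occurs F A 0 N))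
  have hcode : Primrec fun n => (g n).code :=
    Primrec₂.natPair.comp (Primrec.const 4) <| Primrec₂.natPair.comp
      (Primrec₂.natPair.comp (Primrec.const 4) <| Primrec₂.natPair.comp (Primrec.const _)
        (Formula.primrec_code_isPow F A x)) (Primrec.const _)
  have hholds : ∀ n h, (∀ y, WordOver A.letters (h y)) →
      ((g n).Holds h ↔ f.Holds h ∧ h x = List.replicate n 0) := by
    intro n h hh
    simp only [g, Formula.Holds, imp_self, and_true]
    refine and_congr_right fun hfh => ?_
    have hw : h x ∈ haltingWords := hfx ▸ ⟨h, hh, hfh, rfl⟩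
    have hw' := List.eq_replicate_of_mem hw.1
    rw [Formula.isPow_holds_iff F A hw']
    exact ⟨fun h => by rw [hw', h], fun h => by simp [h]⟩
  have hiff : ∀ n, P ((g n).language A N) ↔
      ¬ (Nat.Partrec.Code.eval (Denumerable.ofNat Nat.Partrec.Code n) 0).Dom := by
    intro n
    have hmem : (List.replicate n 0 ∈ haltingWords ↔
        (Nat.Partrec.Code.eval (Denumerable.ofNat Nat.Partrec.Code n) 0).Dom) := by
      simp only [haltingWords, Set.mem_ofPred_eq, List.length_replicate]
      exact ⟨fun h => h.2, fun h => ⟨fun a ha => List.eq_of_mem_replicate ha, h⟩⟩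
    rw [← hmem]
    constructor
    · rw [imp_not_comm, ← hfx]
      rintro ⟨h, hh, hfh, hhx⟩
      refine hinf _ ?_
      refine Set.infinite_of_injective_forall_mem (f := fun k : ℕ => List.replicate k 0)
        (fun a b hab => by simpa using congrArg List.length hab) fun k => ?_
      have hne : ∀ y, f.Occurs y → Function.update h N (List.replicate k 0) y = h y := by
        intro y hy
        refine Function.update_of_ne ?_ _ _
        rintro rfl
        exact hN _ le_rfl hy
      have hover : ∀ y, WordOver A.letters (Function.update h N (List.replicate k 0) y) := by
        intro y
        rcases eq_or_ne y N with rfl | hy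
        · rw [Function.update_self]
          intro a ha
          rw [List.eq_of_mem_replicate ha]
          exact h0
        · rw [Function.update_of_ne hy]
          exact hh y
      exact ⟨_, hover, (hholds n _ hover).2 ⟨(Formula.holds_congr hne).2 hfh, by
        rw [hne x hx, hhx]⟩, Function.update_self ..⟩
    · intro hn
      convert hempty
      refine Set.eq_empty_of_forall_notMem ?_
      rintro w ⟨h, hh, hgh, -⟩
      obtain ⟨hfh, hx⟩ := (hholds n h hh).1 hgh
      exact hn (hfx ▸ ⟨h, hh, hfh, hx⟩)
  refine ComputablePred.halting_problem 0 (ComputablePred.computable_iff.2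
    ⟨fun c => !d (g (Encodable.encode c)).code N, ?_, ?_⟩)
  · exact Primrec.not.to_comp.comp
      (hd.comp (hcode.to_comp.comp Computable.encode) (Computable.const N))
  · funext c
    have := (hdP _ (hg (Encodable.encode c)) N (hgN _)).trans (hiff _)
    rw [Denumerable.ofNat_encode] at this
    simp only [Bool.not_eq_true', ← Bool.not_eq_true, this, not_not]

/-! ### Length-preserving string rewriting -/

section Rewriting

variable {α : Type*}

/-- One rewriting step. A rule is a list of pairs of letters; it replaces the word of the first
components by the word of the second components, which has the same length. -/
def RewStep (R : List (List (α × α))) (s t : List α) : Prop :=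
  ∃ u v, ∃ p ∈ R, s = u ++ p.map Prod.fst ++ v ∧ t = u ++ p.map Prod.snd ++ v

/-- Parallel rewriting: any number of rules are applied at disjoint places. -/
inductive ParRew (R : List (List (α × α))) : List α → List α → Prop
  | nil : ParRew R [] []
  | same (a : α) {s t : List α} : ParRew R s t → ParRew R (a :: s) (a :: t)
  | rule {p : List (α × α)} {s t : List α} : p ∈ R → ParRew R s t →
      ParRew R (p.map Prod.fst ++ s) (p.map Prod.snd ++ t)

variable {R : List (List (α × α))} {s t s' t' : List α}

theorem RewStep.append_left (u : List α) (h : RewStep R s t) : RewStep R (u ++ s) (u ++ t) := by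
  obtain ⟨u', v, p, hp, rfl, rfl⟩ := h
  exact ⟨u ++ u', v, p, hp, by simp, by simp⟩

theorem RewStep.append_right (u : List α) (h : RewStep R s t) : RewStep R (s ++ u) (t ++ u) := by
  obtain ⟨u', v, p, hp, rfl, rfl⟩ := h
  exact ⟨u', v ++ u, p, hp, by simp, by simp⟩

theorem reflTransGen_rewStep_append (u v : List α) (h : Relation.ReflTransGen (RewStep R) s t) :
    Relation.ReflTransGen (RewStep R) (u ++ s ++ v) (u ++ t ++ v) :=
  h.lift (fun w => u ++ w ++ v) fun _ _ h => (h.append_left u).append_right v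

theorem ParRew.refl : ∀ s : List α, ParRew R s s
  | [] => .nil
  | a :: s => .same a (ParRew.refl s)

theorem ParRew.append (h : ParRew R s t) (h' : ParRew R s' t') :
    ParRew R (s ++ s') (t ++ t') := by
  induction h with
  | nil => exact h'
  | same a _ ih => exact .same a ih
  | rule hp _ ih => simpa using .rule hp ih

theorem RewStep.parRew (h : RewStep R s t) : ParRew R s t := by
  obtain ⟨u, v, p, hp, rfl, rfl⟩ := h
  simpa using (ParRew.refl u).append (.rule hp (.refl v))

theorem ParRew.reflTransGen (h : ParRew R s t) : Relation.ReflTransGen (RewStep R) s t := by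
  induction h with
  | nil => exact .refl
  | same a _ ih => simpa using reflTransGen_rewStep_append [a] [] ih
  | @rule p s t hp _ ih =>
    refine .head (b := p.map Prod.snd ++ s) ⟨[], s, p, hp, by simp, by simp⟩ ?_
    simpa using reflTransGen_rewStep_append (p.map Prod.snd) [] ih

theorem ParRew.reverse (h : ParRew R s t) :
    ParRew (R.map List.reverse) s.reverse t.reverse := by
  induction h with
  | nil => exact .nil
  | same a _ ih => simpa using ih.append (.same a .nil)
  | @rule p s t hp _ ih =>
    have := ParRew.rule (List.mem_map_of_mem (f := List.reverse) hp) .nil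
    simpa using ih.append this

theorem parRew_map_reverse_iff :
    ParRew (R.map List.reverse) s.reverse t ↔ ParRew R s t.reverse := by
  constructor
  · intro h
    simpa [List.map_map, Function.comp_def] using h.reverse
  · intro h
    simpa using h.reverse

theorem parRew_nil_rules_iff : ParRew [] s t ↔ s = t := by
  constructor
  · intro h
    induction h with
    | nil => rfl
    | same a _ ih => rw [ih]
    | rule hp => simp at hp
  · rintro rfl
    exact .refl s

theorem ParRew.length_eq (h : ParRew R s t) : s.length = t.length := by
  induction h with
  | nil => rfl
  | same a _ ih => simp [ih]
  | rule hp _ ih => simp [ih]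

/-- A letter that occurs in no rule cuts parallel rewriting into two independent parts. -/
theorem ParRew.exists_of_append_cons {d : α} (hd : ∀ p ∈ R, ∀ x ∈ p, x.1 ≠ d ∧ x.2 ≠ d)
    {w : List α} (h : ParRew R w t) : ∀ {w₀ : List α}, w = w₀ ++ d :: s → d ∉ w₀ →
    ∃ t₀ t₁, t = t₀ ++ d :: t₁ ∧ d ∉ t₀ ∧ ParRew R w₀ t₀ ∧ ParRew R s t₁ := by
  induction h with
  | nil => intro w₀ h; simp at h
  | @same a w t hwt ih =>
    intro w₀ h hw₀
    rcases w₀ with - | ⟨c, w₀⟩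
    · obtain ⟨rfl, rfl⟩ := List.cons.inj h
      exact ⟨[], t, rfl, by simp, .nil, hwt⟩
    · obtain ⟨rfl, rfl⟩ := List.cons.inj h
      simp only [List.mem_cons, not_or] at hw₀
      obtain ⟨t₀, t₁, rfl, h₀, h₁, h₂⟩ := ih rfl hw₀.2
      exact ⟨a :: t₀, t₁, rfl, by simp [h₀, hw₀.1], .same a h₁, h₂⟩
  | @rule p w t hp hwt ih =>
    intro w₀ h hw₀
    have hp₁ : d ∉ p.map Prod.fst := by
      rw [List.mem_map]
      rintro ⟨x, hx, h⟩
      exact (hd p hp x hx).1 h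
    have hp₂ : d ∉ p.map Prod.snd := by
      rw [List.mem_map]
      rintro ⟨x, hx, h⟩
      exact (hd p hp x hx).2 h
    obtain ⟨w', rfl, rfl⟩ : ∃ w', w₀ = p.map Prod.fst ++ w' ∧ w = w' ++ d :: s := by
      rcases List.append_eq_append_iff.1 h with ⟨c, h₁, h₂⟩ | ⟨c, h₁, h₂⟩
      · exact ⟨c, h₁, h₂⟩
      · rcases c with - | ⟨c, c'⟩
        · exact ⟨[], by simpa using h₁.symm, by simpa using h₂.symm⟩
        · obtain ⟨rfl, -⟩ := List.cons.inj h₂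
          exact (hp₁ (by rw [h₁]; simp)).elim
    obtain ⟨t₀, t₁, rfl, h₀, h₁, h₂⟩ := ih rfl fun h => hw₀ (by simp [h])
    exact ⟨p.map Prod.snd ++ t₀, t₁, by simp, by simp [h₀, hp₂], .rule hp h₁, h₂⟩

/-- A history `w₀ d w₁ d ⋯ d wₙ` in which every block arises from its predecessor by parallel
rewriting is checked all at once, by comparing it with itself shifted by one block. -/
theorem reflTransGen_rewStep_of_history {d : α} (hd : ∀ p ∈ R, ∀ x ∈ p, x.1 ≠ d ∧ x.2 ≠ d)
    {w' : List α} (hw' : d ∉ w') : ∀ (U w : List α), d ∉ w →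
    ParRew R (w ++ d :: U) (U ++ d :: w') → Relation.ReflTransGen (RewStep R) w w' := by
  intro U
  induction hn : U.length using Nat.strong_induction_on generalizing U with
  | _ n ih =>
    intro w hw h
    obtain ⟨w₁, t₁, heq, hw₁, h₁, h₂⟩ := h.exists_of_append_cons hd rfl hw
    refine h₁.reflTransGen.trans ?_
    rcases List.append_eq_append_iff.1 heq with ⟨c, e₁, e₂⟩ | ⟨c, e₁, e₂⟩ <;>
      rcases c with - | ⟨c, c'⟩
    · obtain ⟨-, rfl⟩ := List.cons.inj e₂
      obtain rfl : w₁ = U := by simpa using e₁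
      exact h₂.reflTransGen
    · obtain ⟨rfl, -⟩ := List.cons.inj e₂
      exact (hw₁ (by rw [e₁]; simp)).elim
    · obtain ⟨-, rfl⟩ := List.cons.inj e₂
      obtain rfl : U = w₁ := by simpa using e₁
      exact h₂.reflTransGen
    · obtain ⟨rfl, rfl⟩ := List.cons.inj e₂
      subst e₁
      exact ih _ (by rw [← hn]; simp; omega) c' rfl w₁ hw₁ h₂

theorem exists_history_of_reflTransGen_rewStep (d : α)
    (h : Relation.ReflTransGen (RewStep R) s t) :
    ∃ U, ParRew R (s ++ d :: U) (U ++ d :: t) := by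
  induction h using Relation.ReflTransGen.head_induction_on with
  | refl => exact ⟨t, .refl _⟩
  | @head s s' hs _ ih =>
    obtain ⟨U, hU⟩ := ih
    refine ⟨s' ++ d :: U, ?_⟩
    simpa using hs.parRew.append (.same d hU)

end Rewriting

/-! ### Parallel rewriting is checked by visibly pushdown automata -/

section Compare

variable {α : Type} (nm : α → ℕ) (B : ℕ)

/-- The alphabet in which the call letters are the numbers below `B`, and `B + a` is the return
copy of `a`; the return letter `2 * B` marks the end of a word. -/
def copyAlphabet : PushdownAlphabet where
  letters := Finset.range (2 * B + 1)
  kind a := if a < B then .call else .ret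

namespace VPA

/-- The state of `compare` in which the rest `p` of a rule has to be matched. -/
def compareState (p : List (α × α)) : ℕ :=
  Encodable.encode (p.map fun x => (nm x.1, nm x.2)) + 1

theorem compareState_injective {nm : α → ℕ} (hnm : nm.Injective) : (compareState nm).Injective := by
  intro p q h
  have h := Encodable.encode_injective (Nat.succ_injective h)
  refine List.map_injective_iff.2 ?_ h
  rintro ⟨a, b⟩ ⟨c, d⟩ h
  simp only [Prod.mk.injEq] at h
  rw [hnm h.1, hnm h.2]

variable [Fintype α]

/-- The visibly pushdown automaton that accepts `u v' e`, where `u` consists of call letters, `v'` is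
the reversed return copy of a word `v`, and `e` is the end marker, if and only if `u` is
rewritten to `v` in parallel by the mirror images of the rules in `R`. It pushes `u`, and matches
the stack with `v'`; letters are named by `nm`. -/
noncomputable def compare (R : List (List (α × α))) : VPA where
  start := [compareState nm []]
  callTrans := Finset.univ.toList.map fun a => (compareState nm [], nm a, compareState nm [], nm a)
  internalTrans := []
  retTrans :=
    (Finset.univ.toList.map fun a =>
      (compareState nm [], B + nm a, some (nm a), compareState nm [])) ++
    (R.flatMap fun p => p.head?.toList.map fun x =>
      (compareState nm [], B + nm x.2, some (nm x.1), compareState nm p.tail)) ++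
    (R.flatMap fun p => p.tails.flatMap fun q => q.head?.toList.map fun x =>
      (compareState nm q, B + nm x.2, some (nm x.1), compareState nm q.tail)) ++
    [(compareState nm [], 2 * B, none, 0)]
  accept := [0]

variable {nm B} {R : List (List (α × α))}

theorem compare_over (hB : ∀ a, nm a < B) : (compare nm B R).Over (copyAlphabet B) := by
  have h₁ : ∀ a, B + nm a ∈ (copyAlphabet B).letters ∧
      (copyAlphabet B).kind (B + nm a) = .ret := by
    intro a
    have := hB a
    simp only [copyAlphabet, Finset.mem_range]
    exact ⟨by omega, by rw [if_neg (by omega)]⟩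
  refine ⟨?_, by simp [compare], ?_⟩
  · intro t ht
    obtain ⟨a, -, rfl⟩ := List.mem_map.1 ht
    have := hB a
    simp only [copyAlphabet, Finset.mem_range]
    exact ⟨by omega, by rw [if_pos this]⟩
  · intro t ht
    simp only [compare, List.mem_append, List.mem_map, List.mem_flatMap, List.mem_singleton] at ht
    rcases ht with ((⟨a, -, rfl⟩ | ⟨p, -, x, -, rfl⟩) | ⟨p, -, q, -, x, -, rfl⟩) | rfl
    · exact h₁ a
    · exact h₁ x.2
    · exact h₁ x.2
    · simp only [copyAlphabet, Finset.mem_range]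
      exact ⟨by omega, by rw [if_neg (by omega)]⟩

theorem compare_step_call (hnm : nm.Injective) (hB : ∀ a, nm a < B) {a : α} {s : List ℕ}
    {c : ℕ × List ℕ} :
    (compare nm B R).Step (nm a) (compareState nm [], s) c ↔
      c = (compareState nm [], nm a :: s) := by
  have hret : ∀ o q, (compareState nm [], nm a, o, q) ∉ (compare nm B R).retTrans := by
    intro o q ht
    have := ((compare_over hB).2.2 _ ht).2
    simp [copyAlphabet, hB] at this
  obtain ⟨q, s'⟩ := c
  simp only [Step, hret, false_and, exists_false, or_false]
  simp only [compare, List.mem_map, Finset.mem_toList, Finset.mem_univ, true_and, Prod.mk.injEq,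
    List.not_mem_nil, false_and, or_false]
  constructor
  · rintro ⟨_, ⟨b, hb, rfl, rfl⟩, rfl⟩
    obtain rfl := hnm hb
    exact ⟨rfl, rfl⟩
  · rintro ⟨rfl, rfl⟩
    exact ⟨_, ⟨a, rfl, rfl, rfl⟩, rfl⟩

theorem compare_step_end (hnm : nm.Injective) (hB : ∀ a, nm a < B) {p : List (α × α)} {s : List ℕ}
    {c : ℕ × List ℕ} :
    (compare nm B R).Step (2 * B) (compareState nm p, s) c ↔ p = [] ∧ s = [] ∧ c = (0, []) := by
  have hcall : ∀ q g, (compareState nm p, 2 * B, q, g) ∉ (compare nm B R).callTrans := by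
    intro q g ht
    have := ((compare_over hB).1 _ ht).2
    simp [copyAlphabet, show ¬ 2 * B < B by omega] at this
  have h2 : ∀ a, ¬ B + nm a = 2 * B := fun a => by have := hB a; omega
  obtain ⟨q, s'⟩ := c
  simp only [Step, hcall, false_and, exists_false, false_or]
  simp only [compare, List.not_mem_nil, false_and, false_or, List.mem_append, List.mem_map,
    List.mem_flatMap, List.mem_singleton, Prod.mk.injEq, h2, and_false, exists_false,
    reduceCtorEq, true_and, (compareState_injective hnm).eq_iff, and_assoc]
  tauto

/-- The moves of `compare` that read a return letter: an unchanged letter, the first letter of a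
rule, or the next letter of a rule. -/
theorem compare_step_ret (hnm : nm.Injective) (hB : ∀ a, nm a < B) {p : List (α × α)} {b : α}
    {s : List α} {c : ℕ × List ℕ} :
    (compare nm B R).Step (B + nm b) (compareState nm p, s.map nm) c ↔
      ∃ a q s', s = a :: s' ∧ c = (compareState nm q, s'.map nm) ∧
        ((p = [] ∧ a = b ∧ q = []) ∨ (p = [] ∧ (a, b) :: q ∈ R) ∨
          (p = (a, b) :: q ∧ ∃ r ∈ R, p <:+ r)) := by
  have hcall : ∀ q g, (compareState nm p, B + nm b, q, g) ∉ (compare nm B R).callTrans := by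
    intro q g ht
    have := ((compare_over hB).1 _ ht).2
    simp [copyAlphabet] at this
  have h2 : ∀ a, ¬ B + nm a = 2 * B := fun a => by have := hB a; omega
  have hst := compareState_injective hnm
  have key : ∀ o q, (compareState nm p, B + nm b, o, q) ∈ (compare nm B R).retTrans ↔
      ∃ a q', o = some (nm a) ∧ q = compareState nm q' ∧
        ((p = [] ∧ a = b ∧ q' = []) ∨ (p = [] ∧ (a, b) :: q' ∈ R) ∨
          (p = (a, b) :: q' ∧ ∃ r ∈ R, p <:+ r)) := by
    intro o q
    simp only [compare, List.mem_append, List.mem_map, List.mem_flatMap, List.mem_singleton,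
      Prod.mk.injEq, h2, false_and, and_false, or_false, Finset.mem_toList, Finset.mem_univ,
      true_and, Nat.add_left_cancel_iff, hst.eq_iff, hnm.eq_iff, List.mem_tails]
    constructor
    · rintro ((⟨a, rfl, rfl, rfl, rfl⟩ | ⟨r, hr, ⟨a, c⟩, hx, rfl, rfl, rfl, rfl⟩) |
        ⟨r, hr, r', hr', ⟨a, c⟩, hx, rfl, rfl, rfl, rfl⟩)
      · exact ⟨a, [], rfl, rfl, .inl ⟨rfl, rfl, rfl⟩⟩
      · obtain ⟨r', rfl⟩ : ∃ r', r = (a, c) :: r' := by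
          cases r <;> simp_all
        exact ⟨a, r', rfl, rfl, .inr (.inl ⟨rfl, hr⟩)⟩
      · obtain ⟨q, rfl⟩ : ∃ q, r' = (a, c) :: q := by
          cases r' <;> simp_all
        exact ⟨a, q, rfl, rfl, .inr (.inr ⟨rfl, r, hr, hr'⟩)⟩
    · rintro ⟨a, q', rfl, rfl, ⟨rfl, rfl, rfl⟩ | ⟨rfl, hr⟩ | ⟨rfl, r, hr, hr'⟩⟩
      · exact .inl (.inl ⟨a, rfl, rfl, rfl, rfl⟩)
      · exact .inl (.inr ⟨_, hr, (a, b), by simp, rfl, rfl, rfl, rfl⟩)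
      · exact .inr ⟨r, hr, _, hr', (a, b), by simp, rfl, rfl, rfl, rfl⟩
  obtain ⟨q, t⟩ := c
  simp only [Step, hcall, false_and, exists_false, false_or, key]
  simp only [compare, List.not_mem_nil, false_and, false_or, reduceCtorEq, exists_false, or_false,
    Option.some.injEq, Prod.mk.injEq]
  constructor
  · rintro ⟨g, ⟨a, q', rfl, rfl, h⟩, hs⟩
    rcases s with - | ⟨c, s⟩
    · simp at hs
    · obtain ⟨hc, rfl⟩ := List.cons.inj hs
      obtain rfl := hnm hc
      exact ⟨c, q', s, rfl, ⟨rfl, rfl⟩, h⟩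
  · rintro ⟨a, q', s, rfl, ⟨rfl, rfl⟩, h⟩
    exact ⟨nm a, ⟨a, q', rfl, rfl, h⟩, rfl⟩

theorem compare_acceptsFrom_ret_iff (hnm : nm.Injective) (hB : ∀ a, nm a < B) (hR : [] ∉ R)
    {t : List α} {p : List (α × α)} {s : List α} (hp : p = [] ∨ ∃ r ∈ R, p <:+ r) :
    (compare nm B R).AcceptsFrom (compareState nm p, s.map nm)
        (t.map (fun a => B + nm a) ++ [2 * B]) ↔
      ∃ s' t', s = p.map Prod.fst ++ s' ∧ t = p.map Prod.snd ++ t' ∧ ParRew R s' t' := by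
  induction t generalizing p s with
  | nil =>
    simp only [List.map_nil, List.nil_append, AcceptsFrom, compare_step_end hnm hB,
      List.map_eq_nil_iff]
    constructor
    · rintro ⟨_, ⟨rfl, rfl, rfl⟩, -⟩
      exact ⟨[], [], rfl, rfl, .nil⟩
    · rintro ⟨s', t', rfl, ht, h⟩
      obtain ⟨h1, rfl⟩ := List.append_eq_nil_iff.1 ht.symm
      obtain rfl := List.map_eq_nil_iff.1 h1
      obtain rfl : s' = [] := by simpa using h.length_eq
      exact ⟨(0, []), ⟨rfl, rfl, rfl⟩, by simp [compare]⟩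
  | cons b t ih =>
    simp only [List.map_cons, List.cons_append, AcceptsFrom, compare_step_ret hnm hB]
    constructor
    · rintro ⟨_, ⟨a, q, s, rfl, rfl, ⟨rfl, rfl, rfl⟩ | ⟨rfl, hr⟩ | ⟨rfl, r, hr, hr'⟩⟩, h⟩
      · obtain ⟨s', t', rfl, rfl, h'⟩ := (ih (.inl rfl)).1 h
        exact ⟨_, _, rfl, rfl, .same a h'⟩
      · obtain ⟨s', t', rfl, rfl, h'⟩ := (ih (.inr ⟨_, hr, List.suffix_cons ..⟩)).1 h
        exact ⟨_, _, rfl, rfl, .rule hr h'⟩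
      · obtain ⟨s', t', rfl, rfl, h'⟩ := (ih (.inr ⟨r, hr, (List.suffix_cons ..).trans hr'⟩)).1 h
        exact ⟨s', t', rfl, rfl, h'⟩
    · rintro ⟨s', t', rfl, ht, h⟩
      rcases p with - | ⟨⟨a, c⟩, q⟩
      · simp only [List.map_nil, List.nil_append] at ht ⊢
        subst ht
        generalize ht : b :: t = t' at h
        cases h with
        | nil => cases ht
        | @same a s' t' h =>
          obtain ⟨rfl, rfl⟩ := List.cons.inj ht
          exact ⟨_, ⟨b, [], s', rfl, rfl, .inl ⟨trivial, rfl, rfl⟩⟩,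
            (ih (.inl rfl)).2 ⟨_, _, rfl, rfl, h⟩⟩
        | @rule r s' t' hr h =>
          rcases r with - | ⟨⟨a, c⟩, r⟩
          · exact (hR hr).elim
          · obtain ⟨rfl, rfl⟩ := List.cons.inj ht
            exact ⟨_, ⟨a, r, _, rfl, rfl, .inr (.inl ⟨trivial, hr⟩)⟩,
              (ih (.inr ⟨_, hr, List.suffix_cons ..⟩)).2 ⟨_, _, rfl, rfl, h⟩⟩
      · obtain ⟨rfl, rfl⟩ := List.cons.inj ht
        obtain ⟨r, hr, hr'⟩ := hp.resolve_left (by simp)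
        exact ⟨_, ⟨a, q, _, rfl, rfl, .inr (.inr ⟨rfl, r, hr, hr'⟩)⟩,
          (ih (.inr ⟨r, hr, (List.suffix_cons ..).trans hr'⟩)).2 ⟨_, _, rfl, rfl, h⟩⟩

theorem compare_acceptsFrom_call_iff (hnm : nm.Injective) (hB : ∀ a, nm a < B) {u s : List α}
    {v : List ℕ} :
    (compare nm B R).AcceptsFrom (compareState nm [], s.map nm) (u.map nm ++ v) ↔
      (compare nm B R).AcceptsFrom (compareState nm [], (u.reverse ++ s).map nm) v := by
  induction u generalizing s with
  | nil => rfl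
  | cons a u ih =>
    simp only [List.map_cons, List.cons_append, AcceptsFrom, compare_step_call hnm hB,
      exists_eq_left]
    rw [← List.map_cons, ih]
    simp

theorem mem_language_compare_iff (hnm : nm.Injective) (hB : ∀ a, nm a < B) (hR : [] ∉ R)
    {u t : List α} :
    u.map nm ++ t.map (fun a => B + nm a) ++ [2 * B] ∈
      (compare nm B (R.map List.reverse)).language ↔ ParRew R u t.reverse := by
  rw [← parRew_map_reverse_iff]
  simp only [language, Set.mem_ofPred_eq]
  have h1 : (compare nm B (R.map List.reverse)).start = [compareState nm []] := rfl
  simp only [h1, List.mem_singleton, exists_eq_left, List.append_assoc]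
  have h2 := compare_acceptsFrom_call_iff (R := R.map List.reverse) hnm hB (u := u) (s := [])
    (v := t.map (fun a => B + nm a) ++ [2 * B])
  rw [List.map_nil, List.append_nil] at h2
  rw [h2, compare_acceptsFrom_ret_iff hnm hB (by simpa using hR) (.inl rfl)]
  simp

/-- The words over a list of call letters. -/
def calls (T : List ℕ) : VPA := ⟨[0], T.map fun a => (0, a, 0, 0), [], [], [0]⟩

/-- The words over a list of return letters. -/
def rets (T : List ℕ) : VPA := ⟨[0], [], [], T.map fun a => (0, a, none, 0), [0]⟩

theorem mem_language_calls_iff {T w : List ℕ} : w ∈ (calls T).language ↔ ∀ a ∈ w, a ∈ T := by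
  have key : ∀ (w s : List ℕ), (calls T).AcceptsFrom (0, s) w ↔ ∀ a ∈ w, a ∈ T := by
    intro w
    induction w with
    | nil => intro s; simp [AcceptsFrom, calls]
    | cons a w ih =>
      intro s
      have hstep : ∀ d, (calls T).Step a (0, s) d ↔ a ∈ T ∧ d = (0, 0 :: s) := by
        rintro ⟨q, s'⟩
        simp only [Step, calls, List.mem_map, Prod.mk.injEq, List.not_mem_nil]
        grind
      simp [AcceptsFrom, hstep, ih]
  simpa [language, calls] using key w []

theorem mem_language_rets_iff {T w : List ℕ} : w ∈ (rets T).language ↔ ∀ a ∈ w, a ∈ T := by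
  have key : ∀ w : List ℕ, (rets T).AcceptsFrom (0, []) w ↔ ∀ a ∈ w, a ∈ T := by
    intro w
    induction w with
    | nil => simp [AcceptsFrom, rets]
    | cons a w ih =>
      have hstep : ∀ d, (rets T).Step a (0, []) d ↔ a ∈ T ∧ d = (0, []) := by
        rintro ⟨q, s'⟩
        simp only [Step, rets, List.mem_map, Prod.mk.injEq, List.not_mem_nil]
        grind
      simp [AcceptsFrom, hstep, ih]
  simpa [language, rets] using key w

end VPA

end Compare

/-! ### Rewriting systems define expressible languages -/

theorem StrTerm.eval_append (h : ℕ → List ℕ) (s t : StrTerm) :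
    StrTerm.eval h (s ++ t) = StrTerm.eval h s ++ StrTerm.eval h t :=
  List.flatMap_append

theorem StrTerm.eval_map_inr (h : ℕ → List ℕ) (w : List ℕ) :
    StrTerm.eval h (w.map Sum.inr) = w := by
  simp only [StrTerm.eval, List.flatMap_map, Sum.elim_inr]
  exact List.flatMap_singleton' _

theorem exists_eq_map_of_forall_mem {α β : Type*} {g : α → β} {T : List α} {w : List β}
    (h : ∀ b ∈ w, b ∈ T.map g) : ∃ v : List α, (∀ a ∈ v, a ∈ T) ∧ w = v.map g := by
  induction w with
  | nil => exact ⟨[], by simp, rfl⟩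
  | cons b w ih =>
    obtain ⟨a, ha, rfl⟩ := List.mem_map.1 (h b (by simp))
    obtain ⟨v, hv, rfl⟩ := ih fun b hb => h b (by simp [hb])
    exact ⟨a :: v, by simpa using ⟨ha, hv⟩, rfl⟩

theorem Formula.mem_vpa_inTheory {A : PushdownAlphabet} {s : StrTerm} {M : VPA}
    (hs : StrTerm.Over s A.letters) (hM : M.Over A) :
    (Formula.mem s (.vpa M)).InTheory VPLCON A :=
  ⟨nofun, hs, .vpl, rfl, hM⟩

/-- The formula expresses in variable `0` the words that, padded with `b` on both sides and with `c`
and preceded by `u`, can be rewritten to a word that contains the letter `e`. The variables `1`, `2`,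
`3` are the paddings, `6` and `7` are the parts of the final word before and after `e`, `4` is the
history without its first and last word, and `5` is the reversed return copy of the history
without its first word. -/
theorem expressible_rewriting {α : Type} [Fintype α] {nm : α → ℕ} {B : ℕ} (hnm : nm.Injective)
    (hB : ∀ a, nm a < B) {R : List (List (α × α))} (hR : [] ∉ R) {X u : List α} {b c d e : α}
    (hd : ∀ p ∈ R, ∀ x ∈ p, x.1 ≠ d ∧ x.2 ≠ d) (hX : d ∉ X) (hu : d ∉ u) (hb : b ≠ d)
    (hc : c ≠ d) (he : e ≠ d) :
    Expressible VPLCON (copyAlphabet B) {w | ∃ v : List α, (∀ a ∈ v, a ∈ X) ∧ w = v.map nm ∧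
      ∃ i j k y z, d ∉ y ∧ d ∉ z ∧ Relation.ReflTransGen (RewStep R)
        (List.replicate i b ++ u ++ v ++ List.replicate j c ++ List.replicate k b)
        (y ++ e :: z)} := by
  classical
  set C : List ℕ := Finset.univ.toList.map nm with hC
  set D : List α := Finset.univ.toList.filter (· ≠ d) with hD
  have hCmem : ∀ {w : List ℕ}, (∀ a ∈ w, a ∈ C) ↔ ∃ v : List α, w = v.map nm := by
    intro w
    constructor
    · intro h
      obtain ⟨v, -, hv⟩ := exists_eq_map_of_forall_mem h
      exact ⟨v, hv⟩
    · rintro ⟨v, rfl⟩ a ha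
      obtain ⟨x, -, rfl⟩ := List.mem_map.1 ha
      simp [hC]
  have hDmem : ∀ {w : List ℕ}, (∀ a ∈ w, a ∈ D.map nm) ↔ ∃ v : List α, d ∉ v ∧ w = v.map nm := by
    intro w
    constructor
    · intro h
      obtain ⟨v, hv, rfl⟩ := exists_eq_map_of_forall_mem h
      exact ⟨v, fun h => by simpa [hD] using hv d h, rfl⟩
    · rintro ⟨v, hv, rfl⟩ a ha
      obtain ⟨x, hx, rfl⟩ := List.mem_map.1 ha
      exact List.mem_map_of_mem (by simpa [hD] using ne_of_mem_of_not_mem hx hv)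
  have hpow : ∀ {w : List ℕ} {a : α}, (∀ x ∈ w, x ∈ [nm a]) ↔ ∃ i, w = (List.replicate i a).map nm := by
    intro w a
    simp only [List.mem_singleton, List.map_replicate]
    exact ⟨fun h => ⟨_, List.eq_replicate_of_mem h⟩,
      by rintro ⟨i, rfl⟩ x hx; exact List.eq_of_mem_replicate hx⟩
  have hret : ∀ {w : List ℕ}, (∀ a ∈ w, a ∈ C.map (B + ·)) ↔
      ∃ v : List α, w = v.map fun a => B + nm a := by
    intro w
    constructor
    · intro h
      obtain ⟨v, hv, rfl⟩ := exists_eq_map_of_forall_mem h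
      obtain ⟨v, rfl⟩ := hCmem.1 hv
      exact ⟨v, by simp⟩
    · rintro ⟨v, rfl⟩ a ha
      obtain ⟨x, -, rfl⟩ := List.mem_map.1 ha
      simp [hC]
  let step : StrTerm := [Sum.inl 1] ++ (u.map nm).map Sum.inr ++ [Sum.inl 0, Sum.inl 2, Sum.inl 3] ++
    [nm d].map Sum.inr ++ [Sum.inl 4, Sum.inl 5] ++ [2 * B].map Sum.inr
  let copy : StrTerm := [Sum.inl 4] ++ [nm d].map Sum.inr ++ [Sum.inl 6] ++ [nm e].map Sum.inr ++
    [Sum.inl 7, Sum.inl 5] ++ [2 * B].map Sum.inr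
  let calls : ℕ → List ℕ → Formula := fun x T => .mem [Sum.inl x] (.vpa (VPA.calls T))
  let f : Formula :=
    .and (calls 0 (X.map nm)) <| .and (calls 1 [nm b]) <| .and (calls 2 [nm c]) <|
    .and (calls 3 [nm b]) <| .and (calls 4 C) <|
    .and (.mem [Sum.inl 5] (.vpa (VPA.rets (C.map (B + ·))))) <|
    .and (calls 6 (D.map nm)) <| .and (calls 7 (D.map nm)) <|
    .and (.mem step (.vpa (VPA.compare nm B (R.map List.reverse))))
      (.mem copy (.vpa (VPA.compare nm B [])))
  have hletter : ∀ a, nm a ∈ (copyAlphabet B).letters := fun a => by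
    have := hB a
    simp only [copyAlphabet, Finset.mem_range]; omega
  have hend : 2 * B ∈ (copyAlphabet B).letters := by simp [copyAlphabet]
  have hkind : ∀ a, (copyAlphabet B).kind (nm a) = .call := fun a => by simp [copyAlphabet, hB]
  have hcalls : ∀ x (T : List α), (calls x (T.map nm)).InTheory VPLCON (copyAlphabet B) := by
    intro x T
    refine Formula.mem_vpa_inTheory (fun a ha => by simp at ha) ⟨?_, ?_, ?_⟩
    · intro t ht
      simp only [VPA.calls, List.map_map, List.mem_map, Function.comp_apply] at ht
      obtain ⟨a, -, rfl⟩ := ht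
      exact ⟨hletter a, hkind a⟩
    · simp [VPA.calls]
    · simp [VPA.calls]
  have hf : f.InTheory VPLCON (copyAlphabet B) := by
    refine ⟨hcalls 0 X, hcalls 1 [b], hcalls 2 [c], hcalls 3 [b], hcalls 4 _,
      Formula.mem_vpa_inTheory (fun a ha => by simp at ha)
        ⟨by simp [VPA.rets], by simp [VPA.rets], ?_⟩, hcalls 6 D, hcalls 7 D,
      Formula.mem_vpa_inTheory ?_ (VPA.compare_over hB),
      Formula.mem_vpa_inTheory ?_ (VPA.compare_over hB)⟩
    · intro t ht
      simp only [VPA.rets, hC, List.map_map, List.mem_map, Function.comp_apply] at ht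
      obtain ⟨a, -, rfl⟩ := ht
      have := hB a
      simp only [copyAlphabet, Finset.mem_range]
      exact ⟨by omega, by rw [if_neg (by omega)]⟩
    · intro a ha
      simp only [step, List.map_map, List.map_cons, List.map_nil, List.mem_append, List.mem_cons,
        List.not_mem_nil, List.mem_map, Function.comp_apply, Sum.inr.injEq, reduceCtorEq,
        or_false, false_or] at ha
      rcases ha with (⟨x, -, rfl⟩ | rfl) | rfl
      · exact hletter x
      · exact hletter d
      · exact hend
    · intro a ha
      simp only [copy, List.map_cons, List.map_nil, List.mem_append, List.mem_cons,
        List.not_mem_nil, Sum.inr.injEq, reduceCtorEq, or_false, false_or] at ha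
      rcases ha with (rfl | rfl) | rfl
      · exact hletter d
      · exact hletter e
      · exact hend
  refine ⟨f, hf, 0, .inl (by simp [calls, Formula.Occurs, StrTerm.Occurs]), ?_⟩
  have hvar : ∀ h x, StrTerm.eval h [Sum.inl x] = h x := fun h x => by simp [StrTerm.eval]
  have hholds : ∀ h : ℕ → List ℕ, f.Holds h ↔ (∃ v : List α, (∀ a ∈ v, a ∈ X) ∧ h 0 = v.map nm) ∧
      (∃ i, h 1 = (List.replicate i b).map nm) ∧ (∃ i, h 2 = (List.replicate i c).map nm) ∧
      (∃ i, h 3 = (List.replicate i b).map nm) ∧ (∃ v : List α, h 4 = v.map nm) ∧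
      (∃ v : List α, h 5 = v.map fun a => B + nm a) ∧ (∃ v : List α, d ∉ v ∧ h 6 = v.map nm) ∧
      (∃ v : List α, d ∉ v ∧ h 7 = v.map nm) ∧
      StrTerm.eval h step ∈ (VPA.compare nm B (R.map List.reverse)).language ∧
      StrTerm.eval h copy ∈ (VPA.compare nm B []).language := by
    intro h
    have hX' : (∀ a ∈ h 0, a ∈ X.map nm) ↔ ∃ v : List α, (∀ a ∈ v, a ∈ X) ∧ h 0 = v.map nm := by
      refine ⟨exists_eq_map_of_forall_mem, ?_⟩
      rintro ⟨v, hv, hv'⟩ a ha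
      rw [hv'] at ha
      obtain ⟨x, hx, rfl⟩ := List.mem_map.1 ha
      exact List.mem_map_of_mem (hv x hx)
    simp only [f, calls, Formula.Holds, LangSpec.language, hvar, VPA.mem_language_calls_iff,
      VPA.mem_language_rets_iff, hCmem, hDmem, hpow, hret, hX']
  have hstep : ∀ (h : ℕ → List ℕ) (v U V : List α) (i j k : ℕ), h 0 = v.map nm →
      h 1 = (List.replicate i b).map nm → h 2 = (List.replicate j c).map nm →
      h 3 = (List.replicate k b).map nm → h 4 = U.map nm → h 5 = V.map (fun a => B + nm a) →
      (StrTerm.eval h step ∈ (VPA.compare nm B (R.map List.reverse)).language ↔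
        ParRew R ((List.replicate i b ++ u ++ v ++ List.replicate j c ++ List.replicate k b) ++
          d :: U) V.reverse) := by
    intro h v U V i j k h0 h1 h2 h3 h4 h5
    rw [← VPA.mem_language_compare_iff hnm hB hR]
    simp only [step, StrTerm.eval_append, StrTerm.eval_map_inr]
    simp [StrTerm.eval, h0, h1, h2, h3, h4, h5]
  have hcopy : ∀ (h : ℕ → List ℕ) (y z U V : List α), h 6 = y.map nm → h 7 = z.map nm →
      h 4 = U.map nm → h 5 = V.map (fun a => B + nm a) →
      (StrTerm.eval h copy ∈ (VPA.compare nm B []).language ↔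
        U ++ d :: (y ++ e :: z) = V.reverse) := by
    intro h y z U V h6 h7 h4 h5
    rw [← parRew_nil_rules_iff, ← VPA.mem_language_compare_iff hnm hB (by simp)]
    simp only [copy, StrTerm.eval_append, StrTerm.eval_map_inr]
    simp [StrTerm.eval, h6, h7, h4, h5]
  ext w
  constructor
  · rintro ⟨h, -, hh, rfl⟩
    obtain ⟨⟨v, hv, h0⟩, ⟨i, h1⟩, ⟨j, h2⟩, ⟨k, h3⟩, ⟨U, h4⟩, ⟨V, h5⟩, ⟨y, hy, h6⟩, ⟨z, hz, h7⟩,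
      hs, hc'⟩ := (hholds h).1 hh
    refine ⟨v, hv, h0, i, j, k, y, z, hy, hz, ?_⟩
    have hs := (hstep h v U V i j k h0 h1 h2 h3 h4 h5).1 hs
    rw [← (hcopy h y z U V h6 h7 h4 h5).1 hc'] at hs
    refine reflTransGen_rewStep_of_history hd ?_ U _ ?_ hs
    · simp [hy, hz, he.symm]
    · simp only [List.mem_append, List.mem_replicate, hu, hb.symm, hc.symm, and_false, or_false,
        false_or]
      exact fun h => hX (hv d h)
  · rintro ⟨v, hv, rfl, i, j, k, y, z, hy, hz, h⟩
    obtain ⟨U, hU⟩ := exists_history_of_reflTransGen_rewStep d h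
    set V := (U ++ d :: (y ++ e :: z)).reverse with hV
    let g : ℕ → List ℕ
      | 0 => v.map nm
      | 1 => (List.replicate i b).map nm
      | 2 => (List.replicate j c).map nm
      | 3 => (List.replicate k b).map nm
      | 4 => U.map nm
      | 5 => V.map fun a => B + nm a
      | 6 => y.map nm
      | 7 => z.map nm
      | _ => []
    refine ⟨g, ?_, (hholds g).2 ⟨⟨v, hv, rfl⟩, ⟨i, rfl⟩, ⟨j, rfl⟩, ⟨k, rfl⟩, ⟨U, rfl⟩, ⟨V, rfl⟩,
      ⟨y, hy, rfl⟩, ⟨z, hz, rfl⟩, ?_, ?_⟩, rfl⟩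
    · have hw : ∀ s : List α, WordOver (copyAlphabet B).letters (s.map nm) := by
        intro s a ha
        obtain ⟨x, -, rfl⟩ := List.mem_map.1 ha
        exact hletter x
      have hr : ∀ s : List α, WordOver (copyAlphabet B).letters (s.map fun a => B + nm a) := by
        intro s a ha
        obtain ⟨x, -, rfl⟩ := List.mem_map.1 ha
        have := hB x
        simp only [copyAlphabet, Finset.mem_range]
        omega
      intro x
      match x with
      | 0 => exact hw _
      | 1 => exact hw _
      | 2 => exact hw _
      | 3 => exact hw _
      | 4 => exact hw _
      | 5 => exact hr _
      | 6 => exact hw _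
      | 7 => exact hw _
      | n + 8 => intro a ha; simp [g] at ha
    · rw [hstep g v U V i j k rfl rfl rfl rfl rfl rfl, hV, List.reverse_reverse]
      exact hU
    · rw [hcopy g y z U V rfl rfl rfl rfl, hV, List.reverse_reverse]

/-! ### From recursively enumerable languages to Turing machines -/

open Turing

/-- The binary digits of `wordNumber w`, most significant digit first, are `1` followed by `0ᵃ 1` for
every letter `a` of `w`. -/
def wordNumber (w : List ℕ) : ℕ := w.foldl (fun n a => n * 2 ^ (a + 1) + 1) 1

theorem primrec_wordNumber : Primrec wordNumber := by
  have hpow : Primrec fun a : ℕ => 2 ^ (a + 1) := by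
    refine (Primrec.nat_iterate (f := fun a : ℕ => a + 1) (g := fun _ => (1 : ℕ))
      (h := fun _ n => 2 * n) Primrec.succ (Primrec.const 1)
      (Primrec.nat_mul.comp (Primrec.const 2) Primrec.snd)).of_eq fun a => ?_
    generalize a + 1 = b
    induction b with
    | zero => rfl
    | succ b ih => rw [Function.iterate_succ_apply', ih, pow_succ']
  refine Primrec.list_foldl
    (h := fun (_ : List ℕ) (p : ℕ × ℕ) => p.1 * 2 ^ (p.2 + 1) + 1) Primrec.id
    (Primrec.const 1) ?_
  exact Primrec.succ.comp <| Primrec.nat_mul.comp (Primrec.fst.comp Primrec.snd)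
    (hpow.comp (Primrec.snd.comp Primrec.snd))

theorem trNat_two_mul {n : ℕ} (hn : 0 < n) :
    PartrecToTM2.trNat (2 * n) = .bit0 :: PartrecToTM2.trNat n := by
  obtain ⟨p, hp⟩ : ∃ p : PosNum, (n : Num) = .pos p := by
    rcases h : (n : Num) with - | p
    · have : ((n : Num) : ℕ) = 0 := by rw [h]; rfl
      simp at this; omega
    · exact ⟨p, rfl⟩
  have hn' : n = (p : ℕ) := by
    have : ((n : Num) : ℕ) = ((Num.pos p : Num) : ℕ) := by rw [hp]
    simpa using this
  have h2 : ((2 * n : ℕ) : Num) = .pos p.bit0 := by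
    rw [← Num.of_to_nat (.pos p.bit0)]
    congr 1
    rw [hn']
    simp only [Num.cast_pos, PosNum.cast_bit0]
    omega
  rw [PartrecToTM2.trNat, PartrecToTM2.trNat, h2, hp]
  rfl

theorem trNat_two_mul_add_one (n : ℕ) :
    PartrecToTM2.trNat (2 * n + 1) = .bit1 :: PartrecToTM2.trNat n := by
  rcases h : (n : Num) with - | p
  · have h0 : n = 0 := by
      have : ((n : Num) : ℕ) = 0 := by rw [h]; rfl
      simpa using this
    subst h0
    rfl
  · have hn' : n = (p : ℕ) := by
      have : ((n : Num) : ℕ) = ((Num.pos p : Num) : ℕ) := by rw [h]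
      simpa using this
    have h2 : ((2 * n + 1 : ℕ) : Num) = .pos p.bit1 := by
      rw [← Num.of_to_nat (.pos p.bit1)]
      congr 1
      rw [hn']
      simp only [Num.cast_pos, PosNum.cast_bit1]
      omega
    rw [PartrecToTM2.trNat, PartrecToTM2.trNat, h2, h]
    rfl

theorem wordNumber_pos (w : List ℕ) : 0 < wordNumber w := by
  induction w using List.reverseRecOn with
  | nil => exact Nat.one_pos
  | append_singleton w a _ => simp [wordNumber]

theorem reverse_trNat_wordNumber (w : List ℕ) : (PartrecToTM2.trNat (wordNumber w)).reverse =
    .bit1 :: w.flatMap fun a => List.replicate a .bit0 ++ [.bit1] := by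
  have hpow : ∀ a n, 0 < n → PartrecToTM2.trNat (n * 2 ^ a) =
      List.replicate a .bit0 ++ PartrecToTM2.trNat n := by
    intro a n hn
    induction a with
    | zero => simp
    | succ a ih =>
      rw [pow_succ', Nat.mul_left_comm, trNat_two_mul (by positivity), ih]
      rfl
  induction w using List.reverseRecOn with
  | nil => rfl
  | append_singleton w a ih =>
    have h : wordNumber (w ++ [a]) = 2 * (wordNumber w * 2 ^ a) + 1 := by
      simp only [wordNumber, List.foldl_append, List.foldl_cons, List.foldl_nil]
      ring
    rw [h, trNat_two_mul_add_one, hpow _ _ (wordNumber_pos w)]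
    simp [ih]

theorem wordNumber_injective : Function.Injective wordNumber := by
  have key : ∀ w v : List ℕ, (w.flatMap fun a => List.replicate a PartrecToTM2.Γ'.bit0 ++ [.bit1]) =
      (v.flatMap fun a => List.replicate a .bit0 ++ [.bit1]) → w = v := by
    intro w
    induction w with
    | nil => intro v h; cases v <;> simp_all
    | cons a w ih =>
      intro v h
      rcases v with - | ⟨b, v⟩
      · simp at h
      · simp only [List.flatMap_cons, List.append_assoc, List.singleton_append] at h
        have : ∀ a b : ℕ, ∀ s t : List PartrecToTM2.Γ', List.replicate a PartrecToTM2.Γ'.bit0 ++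
            .bit1 :: s = List.replicate b .bit0 ++ .bit1 :: t → a = b ∧ s = t := by
          intro a
          induction a with
          | zero => intro b s t h; cases b <;> simp_all [List.replicate_succ]
          | succ a ih =>
            intro b s t h
            cases b with
            | zero => simp [List.replicate_succ] at h
            | succ b =>
              simp only [List.replicate_succ, List.cons_append, List.cons.injEq, true_and] at h
              obtain ⟨rfl, rfl⟩ := ih b s t h
              exact ⟨rfl, rfl⟩
        obtain ⟨rfl, h'⟩ := this _ _ _ _ h
        rw [ih v h']
  intro w v h
  have := congrArg (fun n => (PartrecToTM2.trNat n).reverse) h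
  simp only [reverse_trNat_wordNumber, List.cons.injEq, true_and] at this
  exact key w v this

/-- Halting on the number of a word is a partial recursive semidecision procedure for `L`. -/
theorem exists_partrec_dom_wordNumber {L : Lang} (hL : REPred fun w => w ∈ L) :
    ∃ f : ℕ →. ℕ, Partrec f ∧ ∀ w, (f (wordNumber w)).Dom ↔ w ∈ L := by
  let p : ℕ → ℕ →. Bool := fun n =>
    ((fun k => decide (wordNumber (Denumerable.ofNat (List ℕ) k) = n) : ℕ → Bool) : ℕ →. Bool)
  have hp : Partrec fun n => Nat.rfind (p n) := by
    refine Partrec.rfind (Computable.partrec ?_)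
    exact (Primrec.eq.decide.comp (primrec_wordNumber.comp ((Primrec.ofNat _).comp Primrec.snd))
      Primrec.fst).to_comp
  have hL' : Partrec fun k : ℕ => (Part.assert (Denumerable.ofNat (List ℕ) k ∈ L)
      fun _ => Part.some ()) := hL.comp (Computable.ofNat _)
  have hf := hp.bind ((hL'.comp Computable.snd).map (Computable.const 0).to₂).to₂
  refine ⟨_, hf, fun w => ?_⟩
  have hrf : Nat.rfind (p (wordNumber w)) = Part.some (Encodable.encode w) := by
    refine Part.eq_some_iff.2 (Nat.mem_rfind.2 ⟨by simp [p], fun {m} hm => ?_⟩)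
    simp only [p, PFun.coe_val, Part.mem_some_iff]
    refine (decide_eq_false fun h => ?_).symm
    have := wordNumber_injective h
    rw [← this, Denumerable.encode_ofNat] at hm
    exact lt_irrefl _ hm
  simp only [hrf, Part.bind_some, Part.map_Dom]
  simp [Part.assert]

/-- Every recursively enumerable language is the halting set of a Turing machine with finitely many
symbols and states; a letter `a` of the input is given to the machine as `0ᵃ 1`. -/
theorem exists_turingMachine {L : Lang} (hL : REPred fun w => w ∈ L) :
    ∃ (Γ Λ : Type) (_ : Finite Γ) (_ : Inhabited Γ) (_ : Inhabited Λ) (M : TM0.Machine Γ Λ)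
      (S : Set Λ) (g z o : Γ), S.Finite ∧ TM0.Supports M S ∧ ∀ w, w ∈ L ↔
        (StateTransition.eval (TM0.step M)
          (TM0.init (g :: o :: w.flatMap fun a => List.replicate a z ++ [o]))).Dom := by
  obtain ⟨f, hf, hfL⟩ := exists_partrec_dom_wordNumber hL
  obtain ⟨c, hc⟩ := ToPartrec.Code.exists_code (Nat.Partrec'.part_iff₁.2 hf)
  let _ : Inhabited PartrecToTM2.Λ' := ⟨PartrecToTM2.trNormal c .halt⟩
  let M₁ := TM2to1.tr PartrecToTM2.tr
  let cell (b : Bool) (a : PartrecToTM2.Γ') :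
      TM2to1.Γ' PartrecToTM2.K' (fun _ => PartrecToTM2.Γ') :=
    (b, Function.update (fun _ => none) .main (some a))
  have : Finite PartrecToTM2.K' := by
    refine Finite.of_surjective (fun i : Fin 4 =>
      ([.main, .rev, .aux, .stack] : List PartrecToTM2.K').get i) ?_
    rintro (- | - | - | -)
    exacts [⟨0, rfl⟩, ⟨1, rfl⟩, ⟨2, rfl⟩, ⟨3, rfl⟩]
  have hfin : Finite (TM2to1.Γ' PartrecToTM2.K' fun _ => PartrecToTM2.Γ') :=
    inferInstanceAs (Finite (Bool × (PartrecToTM2.K' → Option PartrecToTM2.Γ')))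
  refine ⟨_, _, hfin, inferInstance, inferInstance, TM1to0.tr M₁,
    TM1to0.trStmts M₁ (TM2to1.trSupp PartrecToTM2.tr (PartrecToTM2.codeSupp c .halt)),
    cell true .cons, cell false .bit0, cell false .bit1, Finset.finite_toSet _,
    TM1to0.tr_supports _ (TM2to1.tr_supports _ (PartrecToTM2.tr_supports c .halt)), fun w => ?_⟩
  have hinit : cell true .cons :: cell false .bit1 ::
      (w.flatMap fun a => List.replicate a (cell false .bit0) ++ [cell false .bit1]) =
      TM2to1.trInit .main (PartrecToTM2.trList [wordNumber w]) := by
    have hrev : (PartrecToTM2.trList [wordNumber w]).reverse = .cons :: .bit1 ::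
        w.flatMap fun a => List.replicate a .bit0 ++ [.bit1] := by
      simp [reverse_trNat_wordNumber]
    rw [TM2to1.trInit, hrev]
    change _ = cell true .cons :: cell false .bit1 :: List.map (cell false) _
    simp [List.map_flatMap]
  have h0 : (TM0.eval (TM1to0.tr M₁) (TM2to1.trInit .main
      (PartrecToTM2.trList [wordNumber w]))).Dom ↔ w ∈ L := by
    rw [TM1to0.tr_eval]
    refine (TM2to1.tr_eval_dom _ _ _).trans ?_
    have h2 : (TM2.init .main (PartrecToTM2.trList [wordNumber w]) : PartrecToTM2.Cfg') =
        PartrecToTM2.init c [wordNumber w] := by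
      simp only [TM2.init, PartrecToTM2.init]
      congr 1
      funext k
      cases k <;> rfl
    change (StateTransition.eval (TM2.step PartrecToTM2.tr) (TM2.init .main _)).Dom ↔ _
    rw [h2, PartrecToTM2.tr_eval, ← hfL]
    have := hc ⟨[wordNumber w], rfl⟩
    change c.eval [wordNumber w] = _ at this
    rw [this]
    simp only [Part.map_eq_map, Part.map_Dom]
    rfl
  rw [hinit, ← h0, TM0.eval, Part.map_Dom]

/-! ### Turing machines as length-preserving rewriting systems -/

/-- The letters of the rewriting system of a Turing machine with tape symbols `Γ`, states `Q` and
input letters `A`. -/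
inductive TMSym (Γ Q A : Type)
  /-- a tape cell -/
  | cell (c : Γ)
  /-- the tape cell under the head, with the state of the machine -/
  | head (q : Q) (c : Γ)
  /-- an input letter that stands for several tape cells -/
  | raw (a : A)
  /-- free space for the tape cells of an input letter -/
  | space
  /-- the separator between configurations -/
  | sep
  /-- the mark of a halting configuration -/
  | halt

namespace TMSym

instance {Γ Q A : Type} [Finite Γ] [Finite Q] [Finite A] : Finite (TMSym Γ Q A) := by
  let f : TMSym Γ Q A → Γ ⊕ (Q × Γ) ⊕ A ⊕ Fin 3
    | cell c => .inl c
    | head q c => .inr (.inl (q, c))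
    | raw a => .inr (.inr (.inl a))
    | space => .inr (.inr (.inr 0))
    | sep => .inr (.inr (.inr 1))
    | halt => .inr (.inr (.inr 2))
  refine Finite.of_injective f ?_
  rintro (_ | _ | _ | _ | _ | _) (_ | _ | _ | _ | _ | _) h <;> simp_all [f]

end TMSym

theorem append_cons_inj_of_notMem {β : Type*} {x y : β} {A B C D : List β}
    (h : A ++ x :: B = C ++ y :: D) (hC : x ∉ C) (hD : x ∉ D) : A = C ∧ x = y ∧ B = D := by
  rcases List.append_eq_append_iff.1 h with ⟨c, rfl, h₂⟩ | ⟨c, rfl, h₂⟩ <;>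
    rcases c with - | ⟨e, c⟩
  · obtain ⟨rfl, rfl⟩ := List.cons.inj h₂
    exact ⟨by rw [List.append_nil], rfl, rfl⟩
  · obtain ⟨rfl, -⟩ := List.cons.inj h₂
    simp at hC
  · obtain ⟨rfl, rfl⟩ := List.cons.inj h₂
    exact ⟨by rw [List.append_nil], rfl, rfl⟩
  · obtain ⟨rfl, rfl⟩ := List.cons.inj h₂
    simp at hD

section Simulation

variable {Γ Λ : Type} [Inhabited Λ] (M : TM0.Machine Γ Λ) (S : Set Λ) (T : Finset ℕ)
  (z o : Γ)

/-- The tape cells for an input letter. -/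
def inputCells (a : ℕ) : List Γ := List.replicate a z ++ [o]

open TMSym in
/-- The rules of the rewriting system: free space moves to the left through the input, an input
letter followed by enough free space is expanded, and the machine moves. -/
inductive TMRule : List (TMSym Γ S T) → List (TMSym Γ S T) → Prop
  | swap (a : T) : TMRule [raw a, space] [space, raw a]
  | expand (a : T) :
      TMRule (raw a :: List.replicate a space) ((inputCells z o a).map cell)
  | write {q q' : S} {c c' : Γ} : M q c = some (q'.1, .write c') → TMRule [head q c] [head q' c']
  | right {q q' : S} {c : Γ} (b : Γ) : M q c = some (q'.1, .move .right) →
      TMRule [head q c, cell b] [cell c, head q' b]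
  | left {q q' : S} {c : Γ} (b : Γ) : M q c = some (q'.1, .move .left) →
      TMRule [cell b, head q c] [head q' b, cell c]
  | halt {q : S} {c : Γ} : M q c = none → TMRule [head q c] [halt]

variable {M S T z o}

theorem TMRule.length_eq {s t : List (TMSym Γ S T)} (h : TMRule M S T z o s t) :
    s.length = t.length := by
  cases h <;> simp [inputCells]

theorem TMRule.ne_sep {s t : List (TMSym Γ S T)} (h : TMRule M S T z o s t) :
    (∀ x ∈ s, x ≠ .sep) ∧ ∀ x ∈ t, x ≠ .sep := by
  cases h <;> simp +contextual [List.mem_replicate]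

theorem TMRule.ne_nil {s t : List (TMSym Γ S T)} (h : TMRule M S T z o s t) : s ≠ [] := by
  cases h <;> simp

variable (M S T z o) in
/-- The rules of a machine with finitely many symbols and states, as a finite list. -/
theorem exists_list_tmRule [Finite Γ] (hS : S.Finite) : ∃ R : List (List (TMSym Γ S T × TMSym Γ S T)),
    ∀ p, p ∈ R ↔ TMRule M S T z o (p.map Prod.fst) (p.map Prod.snd) := by
  have := hS.to_subtype
  obtain ⟨N, hN⟩ : ∃ N, ∀ a ∈ T, a < N := ⟨T.sup id + 1, fun a ha =>
    Nat.lt_succ_of_le (Finset.le_sup (f := id) ha)⟩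
  have hfin : {p : List (TMSym Γ S T × TMSym Γ S T) |
      TMRule M S T z o (p.map Prod.fst) (p.map Prod.snd)}.Finite := by
    refine (List.finite_length_le (TMSym Γ S T × TMSym Γ S T) (N + 2)).subset fun p hp => ?_
    have hlen : ∀ {s t : List (TMSym Γ S T)}, TMRule M S T z o s t → s.length ≤ N + 2 := by
      intro s t h
      cases h with
      | expand a => have := hN a a.2; simp; omega
      | _ => simp
    simpa using hlen hp
  exact ⟨hfin.toFinset.toList, fun p => by simp⟩

theorem rewStep_iff_tmRule {R : List (List (TMSym Γ S T × TMSym Γ S T))}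
    (hR : ∀ p, p ∈ R ↔ TMRule M S T z o (p.map Prod.fst) (p.map Prod.snd))
    {s t : List (TMSym Γ S T)} : RewStep R s t ↔
      ∃ u v l r, TMRule M S T z o l r ∧ s = u ++ l ++ v ∧ t = u ++ r ++ v := by
  constructor
  · rintro ⟨u, v, p, hp, rfl, rfl⟩
    exact ⟨u, v, _, _, (hR p).1 hp, rfl, rfl⟩
  · rintro ⟨u, v, l, r, h, rfl, rfl⟩
    have h₁ : (l.zip r).map Prod.fst = l := List.map_fst_zip h.length_eq.le
    have h₂ : (l.zip r).map Prod.snd = r := List.map_snd_zip h.length_eq.ge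
    exact ⟨u, v, l.zip r, (hR _).2 (by rwa [h₁, h₂]), by rw [h₁], by rw [h₂]⟩

/-- With enough free space behind it, the input can be expanded into tape cells. -/
theorem reflTransGen_rewStep_input {R : List (List (TMSym Γ S T × TMSym Γ S T))}
    (hR : ∀ p, p ∈ R ↔ TMRule M S T z o (p.map Prod.fst) (p.map Prod.snd)) (v : List T) :
    ∃ j, Relation.ReflTransGen (RewStep R) (v.map .raw ++ List.replicate j .space)
      ((v.flatMap fun a : T => inputCells z o a.1).map .cell) := by
  have hstep : ∀ {u v l r : List (TMSym Γ S T)}, TMRule M S T z o l r →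
      RewStep R (u ++ l ++ v) (u ++ r ++ v) := fun h =>
    (rewStep_iff_tmRule hR).2 ⟨_, _, _, _, h, rfl, rfl⟩
  have hmove : ∀ (n : ℕ) (v : List T), Relation.ReflTransGen (RewStep R)
      (v.map .raw ++ List.replicate n .space) (List.replicate n .space ++ v.map .raw) := by
    have hone : ∀ v : List T, Relation.ReflTransGen (RewStep R)
        (v.map .raw ++ [.space]) (.space :: v.map .raw) := by
      intro v
      induction v with
      | nil => exact .refl
      | cons a v ih =>
        have h := reflTransGen_rewStep_append [.raw a] [] ih
        simp only [List.append_nil, List.singleton_append] at h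
        exact h.tail (by simpa using hstep (u := []) (v := v.map .raw) (.swap a))
    intro n v
    induction n with
    | zero => simpa using .refl
    | succ n ih =>
      rw [List.replicate_succ', List.append_assoc, ← List.append_assoc]
      refine (reflTransGen_rewStep_append [] [.space] ih).trans ?_
      simpa using reflTransGen_rewStep_append (List.replicate n .space) [] (hone v)
  induction v with
  | nil => exact ⟨0, .refl⟩
  | cons a v ih =>
    obtain ⟨j, hj⟩ := ih
    refine ⟨a + j, ?_⟩
    have h₁ := reflTransGen_rewStep_append [.raw a] (List.replicate j .space) (hmove a v)
    have h₂ := hstep (u := []) (v := v.map .raw ++ List.replicate j .space) (.expand a)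
    have h₃ := reflTransGen_rewStep_append ((inputCells z o a).map .cell) [] hj
    simp only [List.nil_append, List.cons_append, List.append_nil, List.append_assoc] at h₁ h₂ h₃
    simp only [List.map_cons, List.cons_append, List.replicate_add, List.flatMap_cons,
      List.map_append]
    exact (h₁.tail h₂).trans h₃

/-- The tape cells that a letter stands for. -/
def TMSym.expand (z o : Γ) : TMSym Γ S T → List (TMSym Γ S T)
  | .raw a => (inputCells z o a).map .cell
  | .space => []
  | x => [x]

theorem flatMap_expand_map_cell {Γ Λ : Type} {S : Set Λ} {T : Finset ℕ} {z o : Γ} (l : List Γ) :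
    (l.map TMSym.cell : List (TMSym Γ S T)).flatMap (TMSym.expand z o) = l.map .cell := by
  induction l with
  | nil => rfl
  | cons a l ih => simp [TMSym.expand, ih]

variable [Inhabited Γ]

/-- The word `w` represents the machine configuration `c`, up to blanks at both ends. -/
def Represents (z o : Γ) (w : List (TMSym Γ S T)) (c : TM0.Cfg Γ Λ) : Prop :=
  ∃ l r : List Γ, ∃ (q : S) (b : Γ),
    w.flatMap (TMSym.expand z o) = l.map .cell ++ .head q b :: r.map .cell ∧
    c = ⟨q, ⟨b, ListBlank.mk l.reverse, ListBlank.mk r⟩⟩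

/-- A rewriting step leaves the represented configuration unchanged, or performs a step of the
machine, or is made in a halting configuration. -/
theorem Represents.of_tmRule {u v l r : List (TMSym Γ S T)} {c : TM0.Cfg Γ Λ}
    (h : TMRule M S T z o l r) (hc : Represents z o (u ++ l ++ v) c) :
    Represents z o (u ++ r ++ v) c ∨
      (∃ c' ∈ TM0.step M c, Represents z o (u ++ r ++ v) c') ∨ TM0.step M c = none := by
  obtain ⟨L, Rt, q₀, b₀, hw, rfl⟩ := hc
  have hcell : ∀ (q : S) (c : Γ) (l : List Γ),
      (TMSym.head q c : TMSym Γ S T) ∉ l.map TMSym.cell := by simp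
  simp only [List.flatMap_append] at hw
  cases h with
  | swap a =>
    refine .inl ⟨L, Rt, q₀, b₀, ?_, rfl⟩
    simp only [List.flatMap_append, ← hw]
    simp [TMSym.expand]
  | expand a =>
    refine .inl ⟨L, Rt, q₀, b₀, ?_, rfl⟩
    have : (List.replicate a TMSym.space : List (TMSym Γ S T)).flatMap (TMSym.expand z o) = [] := by
      rw [List.flatMap_eq_nil_iff]
      intro x hx
      rw [List.eq_of_mem_replicate hx]
      rfl
    simp only [List.flatMap_append, ← hw, flatMap_expand_map_cell, List.flatMap_cons, this]
    simp [TMSym.expand]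
  | @write q q' c c' hM =>
    simp only [List.flatMap_cons, TMSym.expand, List.flatMap_nil, List.append_assoc,
      List.cons_append, List.nil_append, List.append_nil] at hw
    obtain ⟨hA, hh, hB⟩ := append_cons_inj_of_notMem hw (hcell _ _ _) (hcell _ _ _)
    obtain ⟨rfl, rfl⟩ : q = q₀ ∧ c = b₀ := by simpa using hh
    refine .inr (.inl ⟨_, ?_, L, Rt, q', c', ?_, rfl⟩)
    · simp [TM0.step, hM, Tape.write]
    · simp [TMSym.expand, hA, hB]
  | @right q q' c b hM =>
    simp only [List.flatMap_cons, TMSym.expand, List.flatMap_nil, List.append_assoc,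
      List.cons_append, List.nil_append, List.append_nil] at hw
    obtain ⟨hA, hh, hB⟩ := append_cons_inj_of_notMem hw (hcell _ _ _) (hcell _ _ _)
    obtain ⟨rfl, rfl⟩ : q = q₀ ∧ c = b₀ := by simpa using hh
    rcases Rt with - | ⟨b', Rt⟩
    · simp at hB
    obtain ⟨rfl, hB'⟩ : b = b' ∧ _ := by simpa using hB
    refine .inr (.inl ⟨_, ?_, L ++ [c], Rt, q', b, ?_, rfl⟩)
    · simp [TM0.step, hM, Tape.move]
    · simp [TMSym.expand, hA, hB']
  | @left q q' c b hM =>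
    simp only [List.flatMap_cons, TMSym.expand, List.flatMap_nil, List.append_assoc,
      List.cons_append, List.nil_append, List.append_nil] at hw
    rw [List.append_cons] at hw
    obtain ⟨hA, hh, hB⟩ := append_cons_inj_of_notMem hw (hcell _ _ _) (hcell _ _ _)
    obtain ⟨rfl, rfl⟩ : q = q₀ ∧ c = b₀ := by simpa using hh
    obtain ⟨L, L', rfl, hA', hb⟩ := List.map_eq_append_iff.1 hA.symm
    obtain ⟨b', rfl, hb⟩ := List.map_eq_singleton_iff.1 hb
    obtain rfl : b' = b := by simpa using hb
    refine .inr (.inl ⟨_, ?_, L, c :: Rt, q', b', ?_, rfl⟩)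
    · simp [TM0.step, hM, Tape.move]
    · simp [TMSym.expand, hA', hB]
  | @halt q c hM =>
    simp only [List.flatMap_cons, TMSym.expand, List.flatMap_nil, List.append_assoc,
      List.cons_append, List.nil_append, List.append_nil] at hw
    obtain ⟨hA, hh, hB⟩ := append_cons_inj_of_notMem hw (hcell _ _ _) (hcell _ _ _)
    obtain ⟨rfl, rfl⟩ : q = q₀ ∧ c = b₀ := by simpa using hh
    exact .inr (.inr (by simp [TM0.step, hM]))

theorem dom_of_reflTransGen_rewStep {R : List (List (TMSym Γ S T × TMSym Γ S T))}
    (hR : ∀ p, p ∈ R ↔ TMRule M S T z o (p.map Prod.fst) (p.map Prod.snd))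
    {s t : List (TMSym Γ S T)} {c : TM0.Cfg Γ Λ} (hc : Represents z o s c)
    (h : Relation.ReflTransGen (RewStep R) s t) (ht : .halt ∈ t) :
    (StateTransition.eval (TM0.step M) c).Dom := by
  have key : (∃ c', StateTransition.Reaches (TM0.step M) c c' ∧ Represents z o t c') ∨
      (StateTransition.eval (TM0.step M) c).Dom := by
    clear ht
    induction h with
    | refl => exact .inl ⟨c, .refl, hc⟩
    | tail _ hs ih =>
      rcases ih with ⟨c', hcc', hc'⟩ | hdom
      · obtain ⟨u, v, l, r, hlr, rfl, rfl⟩ := (rewStep_iff_tmRule hR).1 hs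
        rcases hc'.of_tmRule hlr with h | ⟨d, hd, h⟩ | h
        · exact .inl ⟨c', hcc', h⟩
        · exact .inl ⟨d, hcc'.tail hd, h⟩
        · exact .inr (Part.dom_iff_mem.2 ⟨c', StateTransition.mem_eval.2 ⟨hcc', h⟩⟩)
      · exact .inr hdom
  refine key.resolve_left ?_
  rintro ⟨_, -, l, r, q, b, hw, -⟩
  have : (TMSym.halt : TMSym Γ S T) ∈ t.flatMap (TMSym.expand z o) :=
    List.mem_flatMap.2 ⟨_, ht, by simp [TMSym.expand]⟩
  simp [hw] at this

/-- With enough cells on both sides of the head, the rewriting system simulates the machine. -/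
theorem exists_reflTransGen_rewStep_of_reaches {R : List (List (TMSym Γ S T × TMSym Γ S T))}
    (hR : ∀ p, p ∈ R ↔ TMRule M S T z o (p.map Prod.fst) (p.map Prod.snd))
    (hS : TM0.Supports M S) {c d : TM0.Cfg Γ Λ} (h : StateTransition.Reaches (TM0.step M) c d)
    (hd : TM0.step M d = none) : ∃ n, ∀ (l r : List Γ) (q : S) (b : Γ),
      c = ⟨q, ⟨b, ListBlank.mk l.reverse, ListBlank.mk r⟩⟩ → n ≤ l.length → n ≤ r.length →
      ∃ l' r' : List Γ, Relation.ReflTransGen (RewStep R)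
        (l.map .cell ++ .head q b :: r.map .cell) (l'.map .cell ++ .halt :: r'.map .cell) := by
  have hstep : ∀ {u v l r : List (TMSym Γ S T)}, TMRule M S T z o l r →
      RewStep R (u ++ l ++ v) (u ++ r ++ v) := fun h =>
    (rewStep_iff_tmRule hR).2 ⟨_, _, _, _, h, rfl, rfl⟩
  induction h using Relation.ReflTransGen.head_induction_on with
  | refl =>
    refine ⟨0, ?_⟩
    rintro l r q b rfl - -
    have hM : M q b = none := by simpa [TM0.step] using hd
    exact ⟨l, r, .single (by simpa using hstep (u := l.map .cell) (v := r.map .cell) (.halt hM))⟩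
  | @head c c' hcc' _ ih =>
    obtain ⟨n, hn⟩ := ih
    refine ⟨n + 1, ?_⟩
    rintro l r q b rfl hl hr
    obtain ⟨⟨q', a⟩, hM, rfl⟩ := Option.map_eq_some_iff.1 hcc'
    have hq' : q' ∈ S := hS.2 hM q.2
    rcases a with (- | -) | b'
    · obtain ⟨l, x, rfl⟩ : ∃ l' x, l = l' ++ [x] :=
        ⟨_, _, (List.dropLast_append_getLast (List.ne_nil_of_length_pos (by omega))).symm⟩
      obtain ⟨l', r', h⟩ := hn l (b :: r) ⟨q', hq'⟩ x (by simp [Tape.move])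
        (by simpa using hl) (by simp; omega)
      have h₀ := hstep (u := l.map .cell) (v := r.map .cell)
        (.left (z := z) (o := o) (q' := ⟨q', hq'⟩) x hM)
      exact ⟨l', r', .head (by simpa using h₀) (by simpa using h)⟩
    · obtain ⟨x, r, rfl⟩ : ∃ x r', r = x :: r' :=
        List.exists_cons_of_ne_nil (List.ne_nil_of_length_pos (by omega))
      obtain ⟨l', r', h⟩ := hn (l ++ [b]) r ⟨q', hq'⟩ x (by simp [Tape.move])
        (by simp; omega) (by simpa using hr)
      have h₀ := hstep (u := l.map .cell) (v := r.map .cell)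
        (.right (z := z) (o := o) (q' := ⟨q', hq'⟩) x hM)
      exact ⟨l', r', .head (by simpa using h₀) (by simpa using h)⟩
    · obtain ⟨l', r', h⟩ := hn l r ⟨q', hq'⟩ b' (by simp [Tape.write]) (by omega) (by omega)
      have h₀ := hstep (u := l.map .cell) (v := r.map .cell)
        (.write (z := z) (o := o) (q' := ⟨q', hq'⟩) hM)
      exact ⟨l', r', .head (by simpa using h₀) h⟩

end Simulation

/-- Every recursively enumerable language is expressible: the rewriting system of a Turing machine
for the language is run on the word, padded with blanks and free space. -/
theorem expressible_of_rePred {T : Finset ℕ} {L : Lang} (hT : ∀ w ∈ L, WordOver T w)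
    (hL : REPred fun w => w ∈ L) : ∃ A, Expressible VPLCON A L := by
  obtain ⟨Γ, Λ, _, _, _, M, S, g, z, o, hfin, hS, hM⟩ := exists_turingMachine hL
  have := hfin.to_subtype
  obtain ⟨R, hR⟩ := exists_list_tmRule M S T z o hfin
  have _ := Fintype.ofFinite (TMSym Γ S T)
  obtain ⟨N, hN⟩ : ∃ N, ∀ a ∈ T, a < N := ⟨T.sup id + 1, fun a ha =>
    Nat.lt_succ_of_le (Finset.le_sup (f := id) ha)⟩
  let e := Fintype.equivFin (TMSym Γ S T)
  -- the input letters keep their names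
  let nm : TMSym Γ S T → ℕ
    | .raw a => a
    | x => N + e x
  have hlt : ∀ a : T, (a : ℕ) < N := fun a => hN a a.2
  have hraw : ∀ a : T, nm (.raw a) = a := fun _ => rfl
  have hnm' : ∀ x, (∃ a, x = .raw a) ∨ nm x = N + e x := by
    rintro (_ | _ | a | _ | _ | _)
    exacts [.inr rfl, .inr rfl, .inl ⟨a, rfl⟩, .inr rfl, .inr rfl, .inr rfl]
  have hnm : nm.Injective := by
    intro x y h
    rcases hnm' x with ⟨a, rfl⟩ | hx <;> rcases hnm' y with ⟨b, rfl⟩ | hy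
    · rw [Subtype.ext h]
    · rw [hraw, hy] at h; have := hlt a; omega
    · rw [hraw, hx] at h; have := hlt b; omega
    · rw [hx, hy] at h
      exact e.injective (Fin.ext (by omega))
  have hB : ∀ x, nm x < N + Fintype.card (TMSym Γ S T) := by
    intro x
    rcases hnm' x with ⟨a, rfl⟩ | hx
    · rw [hraw]; have := hlt a; omega
    · rw [hx]; have := (e x).2; omega
  have hsep : ∀ p ∈ R, ∀ x ∈ p, x.1 ≠ TMSym.sep ∧ x.2 ≠ TMSym.sep := fun p hp x hx =>
    ⟨((hR p).1 hp).ne_sep.1 _ (List.mem_map_of_mem hx),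
      ((hR p).1 hp).ne_sep.2 _ (List.mem_map_of_mem hx)⟩
  let q₀ : S := ⟨default, hS.1⟩
  have hexp := expressible_rewriting (X := Finset.univ.toList.map TMSym.raw)
    (u := [.head q₀ g, .cell o]) (b := .cell default) (c := .space) (d := .sep) (e := .halt) hnm hB
    (fun h => ((hR []).1 h).ne_nil rfl) hsep (by simp) (by simp) (by simp) (by simp) (by simp)
  refine ⟨copyAlphabet (N + Fintype.card (TMSym Γ S T)), ?_⟩
  convert hexp using 1
  have hmk : ∀ (l : List Γ) (k : ℕ), ListBlank.mk (l ++ List.replicate k default) = ListBlank.mk l :=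
    fun l k => Quotient.sound' (Or.inr ⟨k, rfl⟩)
  have hinit : ∀ (w : List ℕ) (i k : ℕ),
      (TM0.init (g :: o :: w.flatMap fun a => List.replicate a z ++ [o]) : TM0.Cfg Γ Λ) =
        ⟨q₀.1, ⟨g, ListBlank.mk (List.replicate i default).reverse,
          ListBlank.mk (o :: (w.flatMap fun a => inputCells z o a) ++ List.replicate k default)⟩⟩ := by
    intro w i k
    rw [hmk, List.reverse_replicate, ← List.nil_append (List.replicate i default), hmk]
    rfl
  ext w
  constructor
  · intro hw
    obtain ⟨v, rfl⟩ : ∃ v : List T, w = v.map Subtype.val := by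
      obtain ⟨v, -, hv⟩ := exists_eq_map_of_forall_mem (g := Subtype.val)
        (T := (Finset.univ.toList : List T)) (w := w) fun a ha => by simpa using hT w hw a ha
      exact ⟨v, hv⟩
    have hmem : ∀ a ∈ v.map TMSym.raw, a ∈ Finset.univ.toList.map (TMSym.raw : T → TMSym Γ S T) := by
      intro a ha
      obtain ⟨x, -, rfl⟩ := List.mem_map.1 ha
      exact List.mem_map_of_mem (by simp)
    refine ⟨v.map .raw, hmem, by simp [nm, Function.comp_def], ?_⟩
    obtain ⟨d, hd⟩ := Part.dom_iff_mem.1 ((hM _).1 hw)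
    obtain ⟨hd, hd'⟩ := StateTransition.mem_eval.1 hd
    obtain ⟨n, hn⟩ := exists_reflTransGen_rewStep_of_reaches hR hS hd hd'
    obtain ⟨j, hj⟩ := reflTransGen_rewStep_input hR v
    obtain ⟨l, r, h⟩ := hn _ _ _ _ (hinit _ n n) (by simp) (by simp; omega)
    refine ⟨n, j, n, l.map .cell, r.map .cell, by simp, by simp, ?_⟩
    have h₁ := reflTransGen_rewStep_append (List.replicate n (.cell default) ++ [.head q₀ g, .cell o])
      (List.replicate n (.cell default)) hj
    simp only [List.append_assoc, List.cons_append, List.nil_append] at h₁ ⊢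
    refine h₁.trans ?_
    simpa [List.flatMap_map] using h
  · rintro ⟨v, hv, rfl, i, j, k, y, t, -, -, h⟩
    obtain ⟨v, -, rfl⟩ := exists_eq_map_of_forall_mem hv
    rw [hM]
    refine dom_of_reflTransGen_rewStep hR (z := z) (o := o) ?_ h (by simp)
    rw [hinit _ i k]
    refine ⟨_, _, q₀, g, ?_, rfl⟩
    have h₁ : (List.replicate j TMSym.space : List (TMSym Γ S T)).flatMap (TMSym.expand z o) = [] := by
      rw [List.flatMap_eq_nil_iff]
      intro x hx
      rw [List.eq_of_mem_replicate hx]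
      rfl
    have h₂ : ∀ m, (List.replicate m (.cell default) : List (TMSym Γ S T)).flatMap
        (TMSym.expand z o) = List.replicate m (.cell default) := fun m => by
      rw [← List.map_replicate, flatMap_expand_map_cell]
    simp [h₁, h₂, TMSym.expand, nm, List.flatMap_map, List.map_flatMap]

theorem RELanguages_subset : RELanguages ⊆ VPLCON.expressibleLanguages := by
  rintro L ⟨⟨T, hT⟩, hL⟩
  exact expressible_of_rePred hT hL

end StringConstraints

theorem mainTheorem1 :
    StringConstraints.VPLCON.expressibleLanguages = StringConstraints.RELanguages ∧
    (∃ A, ¬ StringConstraints.DecidableInTheory StringConstraints.VPLCON A (fun L => L = ∅) ∧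
      ¬ StringConstraints.DecidableInTheory StringConstraints.VPLCON A Set.Finite) ∧
    (∀ F : StringConstraints.Family, StringConstraints.VPLCON.Below F →
      ∃ A, ¬ StringConstraints.DecidableInTheory F A (fun L => L = ∅) ∧
        ¬ StringConstraints.DecidableInTheory F A Set.Finite) := by
  open StringConstraints in
  have hF : ∀ F : Family, VPLCON.Below F →
      ∃ A, ¬ DecidableInTheory F A (fun L => L = ∅) ∧ ¬ DecidableInTheory F A Set.Finite := by
    intro F hF
    obtain ⟨A, hA⟩ := RELanguages_subset haltingWords_mem_RELanguages
    obtain ⟨B, hB⟩ := hF A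
    exact ⟨B, not_decidableInTheory_of_expressible (hB _ hA) rfl fun L hL => hL.nonempty.ne_empty,
      not_decidableInTheory_of_expressible (hB _ hA) Set.finite_empty fun L hL => hL⟩
  exact ⟨StringConstraints.VPLCON_expressibleLanguages_subset.antisymm
    StringConstraints.RELanguages_subset, hF _ fun A => ⟨A, fun _ h => h⟩, hF⟩
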